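/- Let $\Psi\in C^2((0,\infty))$ and put $p(\rho)=\rho\Psi'(\rho)-\Psi(\rho)$. Let $m\in\mathbb R$ and $\Psi^m(\rho)=\Psi(\rho)-\frac{m^2}{2\rho}$. Assume that there are $0<\rho_g^m<\rho_\ell^m$ such that one line is tangent to the graph of $\Psi^m$ at both $(\rho_g^m,\Psi^m(\rho_g^m))$ and $(\rho_\ell^m,\Psi^m(\rho_\ell^m))$, and such that on some neighbourhood of $[\rho_g^m,\rho_\ell^m]$ the graph of $\Psi^m$ lies strictly above this line except at the points $\rho_g^m$ and $\rho_\ell^m$. Let $\rho_*\in(\rho_g^m,\rho_\ell^m)$. For a viscosity $\bar\mu=\bar\mu(\rho)$ and a constant $\varepsilon>0$ consider the stationary system on $\mathbb R$ with constant momentum $m$ (so that $\partial_x m=0$) and velocity $u=m/\rho$, $$\partial_x\Big(\frac{m^2}{\rho}\Big)+\partial_x p(\rho)-\partial_x\big(\bar\mu(\rho)\,\partial_x u\big)=\rho\,\partial_x\big(\varepsilon\,\partial_x^2\rho\big). \qquad (*)$$ Then there exist $\varepsilon_0>0$, depending only on $\Psi,m,\rho_g^m,\rho_\ell^m,\rho_*$,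 and functions $\rho_{\varepsilon,\omega}:\mathbb R\to\mathbb R$ for all $\varepsilon,\omega>0$ with $\varepsilon/\omega^2<\varepsilon_0$, such that the following holds. 1. For all $\varepsilon,\omega>0$ with $\varepsilon/\omega^2<\varepsilon_0$, the function $\rho=\rho_{\varepsilon,\omega}$ is a non-constant, $\omega$-periodic, positive classical solution of $(*)$ with $\bar\mu=0$ (the Euler--Korteweg case), it satisfies $$\frac1\omega\int_0^\omega\rho_{\varepsilon,\omega}\,dx=\rho_*,$$ and its values lie in $[\rho_g^m,\rho_\ell^m]$. If $m\neq0$, the velocity $u=m/\rho_{\varepsilon,\omega}$ is not a constant function. 2. If $m=0$, then for every viscosity $\bar\mu$ with $\bar\mu(\rho)>0$ for $\rho>0$, the same functions $\rho_{\varepsilon,\omega}$ also solve $(*)$ with this $\bar\mu$, and the velocity is constant. 3. For every $\omega>0$ there is an $\omega$-periodic function $\rho_0$ with values in $\{\rho_g^m,\rho_\ell^m\}$ and exactly two jumps per period such that $\int_0^\omega|\rho_{\varepsilon,\omega}-\rho_0|\,dx\to0$ as $\varepsilon\downarrow0$. -/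

import Mathlib

open Set Filter Topology

noncomputable section

/-- The pressure `p(ρ) = ρ Ψ'(ρ) - Ψ(ρ)` of a fluid with (volume specific) available energy `Ψ`. -/
def pressure (Ψ : ℝ → ℝ) (r : ℝ) : ℝ := r * deriv Ψ r - Ψ r

/-- The modified energy `Ψ^m(ρ) = Ψ(ρ) - m² / (2ρ)`. -/
def modifiedEnergy (Ψ : ℝ → ℝ) (m : ℝ) (r : ℝ) : ℝ := Ψ r - m ^ 2 / (2 * r)

/-- The velocity `u = m / ρ`. -/
def velocity (ρ m : ℝ → ℝ) (x : ℝ) : ℝ := m x / ρ x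

/-- The line tangent to the graph of `Φ` at `(a, Φ a)`. -/
def tangentLine (Φ : ℝ → ℝ) (a r : ℝ) : ℝ := deriv Φ a * (r - a) + Φ a

/-- `0 < a < b`, one line is tangent to the graph of `Φ` both at `(a, Φ a)` and at `(b, Φ b)`, and
on a neighbourhood of `[a, b]` the graph lies strictly above that line except at `a` and `b`. -/
structure IsBitangentDoubleWell (Φ : ℝ → ℝ) (a b : ℝ) : Prop where
  pos : 0 < a
  lt : a < b
  tangent_value : tangentLine Φ a b = Φ b
  tangent_slope : deriv Φ a = deriv Φ b
  above : ∃ δ : ℝ, 0 < δ ∧ ∀ r ∈ Ioo (a - δ) (b + δ), r ≠ a → r ≠ b → tangentLine Φ a r < Φ r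

/-- Classical stationary solutions `(ρ, m)` on `ℝ`, with positive density, of the one-dimensional
isothermal Navier-Stokes-Korteweg system with available energy `Ψ`, viscosity `μ = μ(ρ)` and
Korteweg relaxation parameter `κ = κ(ρ)`:
`∂ₓ m = 0`, `∂ₓ(m²/ρ) + ∂ₓ p(ρ) - ∂ₓ(μ(ρ) ∂ₓ u) = ρ ∂ₓ(κ(ρ) ∂ₓ² ρ)`, where `u = m / ρ`.
The Euler-Korteweg case is `μ = 0`. All quantities that are differentiated are of class `C¹`. -/
structure IsStationarySolution (Ψ μ κ : ℝ → ℝ) (ρ m : ℝ → ℝ) : Prop where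
  density_pos : ∀ x, 0 < ρ x
  density_C2 : ContDiff ℝ 2 ρ
  momentum_C1 : ContDiff ℝ 1 m
  pressure_C1 : ContDiff ℝ 1 (fun x => pressure Ψ (ρ x))
  viscous_C1 : ContDiff ℝ 1 (fun x => μ (ρ x) * deriv (velocity ρ m) x)
  capillary_C1 : ContDiff ℝ 1 (fun x => κ (ρ x) * deriv (deriv ρ) x)
  mass_eq : ∀ x, deriv m x = 0
  momentum_eq : ∀ x,
    deriv (fun y => m y ^ 2 / ρ y) x + deriv (fun y => pressure Ψ (ρ y)) x
        - deriv (fun y => μ (ρ y) * deriv (velocity ρ m) y) x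
      = ρ x * deriv (fun y => κ (ρ y) * deriv (deriv ρ) y) x

/-- `f` is constant. -/
def IsConstantFunction (f : ℝ → ℝ) : Prop := ∃ c : ℝ, ∀ x, f x = c

/-- `f` is an `ω`-periodic function with values in `{a, b}` (to be used with `a ≠ b`) which has
exactly two jumps per period: it jumps from `a` to `b` at `s`, from `b` to `a` at `t`, where
`s < t < s + ω`, and is constant in between. -/
def HasExactlyTwoJumps (ω a b : ℝ) (f : ℝ → ℝ) : Prop :=
  Function.Periodic f ω ∧ (∀ x, f x = a ∨ f x = b) ∧
    ∃ s t : ℝ, s < t ∧ t < s + ω ∧ (∀ x ∈ Ioo s t, f x = b) ∧ (∀ x ∈ Ioo t (s + ω), f x = a)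

end

/-! The momentum equation with constant momentum `m` and no viscosity is `ρ` times the derivative of
`ε ρ'' = (Ψ^m)'(ρ) - k`. Put `W = Ψ^m - (double tangent)` on `[ρg, ρl]`: a double well, which is
continued to `ℝ` as a `C¹` function, positive off the wells, with derivative `w` and `|w| ≤ B`. After
rescaling half a period to `[0, 1]`, with `η = 4 ε / ω²`, a monotone solution with mean value `ρs` of the Neumann
problem `η R'' = w(R) - λ` is needed; its even `2`-periodic extension is then a solution on `ℝ`.

The profile `R` is found by minimising the van der Waals energy `∫ (η / 2) R'² + W(R)` over profiles
of mean value `ρs` whose slope `g = R'` is nonnegative, Lipschitz with constant `2 B / η`, and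
zero at `0`. This class of slopes is compact by the Arzelà-Ascoli theorem, so a minimiser exists.
With the flux `Q(x) = ∫₀ˣ (w(R) - λ)` the first variation of the energy in direction `d` is
`∫ (η g - Q) d`. The slope `Q⁺ / η` is itself admissible, and testing with `d = Q⁺ / η - g` yields
`η g = Q⁺` (`eq_max_flux_of_isMinOn`). The obstacle `g ≥ 0` is not active in the sense that `Q ≥ 0`
(`flux_nonneg`), so `η R' = Q`, which is the profile equation. The first integral of this equation
shows that `R` takes its values in `[ρg, ρl]` (`mem_Icc_of_first_integral`).

Smoothed step functions show that the minimal energy tends to `0` with `η`, and with it `∫ W(R)`.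
Constant profiles have `∫ W(R) = W(ρs) > 0`, so `R` is not constant for small `η`. Moreover `R`
approaches the set of wells in the mean, and since it is monotone with prescribed mean value, it
converges in `L¹` to the step function with jump at `(ρl - ρs) / (ρl - ρg)`
(`integral_abs_sub_step_le`). -/

/-! ### The variational problem on half a period -/

/-- A double well potential `W : ℝ → ℝ` with derivative `w`: it vanishes exactly at the two wells
`a < b`, is positive elsewhere, and is of class `C¹` with derivative bounded by `B`. -/
structure IsDoubleWell (W w : ℝ → ℝ) (a b B : ℝ) : Prop where
  lt : a < b
  hasDerivAt : ∀ r, HasDerivAt W (w r) r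
  continuous_deriv : Continuous w
  bound_pos : 0 < B
  bound : ∀ r, |w r| ≤ B
  left : W a = 0
  right : W b = 0
  pos : ∀ r, r ≠ a → r ≠ b → 0 < W r

theorem IsDoubleWell.continuous {W w : ℝ → ℝ} {a b B : ℝ} (h : IsDoubleWell W w a b B) :
    Continuous W :=
  continuous_iff_continuousAt.2 fun r => (h.hasDerivAt r).continuousAt

theorem IsDoubleWell.nonneg {W w : ℝ → ℝ} {a b B : ℝ} (h : IsDoubleWell W w a b B) (r : ℝ) :
    0 ≤ W r := by
  rcases eq_or_ne r a with rfl | ha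
  · exact h.left.ge
  rcases eq_or_ne r b with rfl | hb
  · exact h.right.ge
  exact (h.pos r ha hb).le

/-- The density on `[0, 1]` with slope `g` and mean value `c`. -/
noncomputable def densityOfSlope (c : ℝ) (g : ℝ → ℝ) (x : ℝ) : ℝ :=
  c + (∫ y in (0 : ℝ)..x, g y) - ∫ z in (0 : ℝ)..1, ∫ y in (0 : ℝ)..z, g y

/-- The van der Waals energy on `[0, 1]` of the density with slope `g` and mean value `c`. -/
noncomputable def slopeEnergy (W : ℝ → ℝ) (η c : ℝ) (g : ℝ → ℝ) : ℝ :=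
  ∫ x in (0 : ℝ)..1, (η / 2 * g x ^ 2 + W (densityOfSlope c g x))

/-- The mean value of `w ∘ R` on `[0, 1]`: the Lagrange multiplier of the mass constraint. -/
noncomputable def multiplier (w R : ℝ → ℝ) : ℝ := ∫ z in (0 : ℝ)..1, w (R z)

/-- The primitive of `w ∘ R - λ` that vanishes at `0`, where `λ` is the Lagrange multiplier; it
equals `η R'` when `R` solves `η R'' = w(R) - λ` with `R'(0) = 0`. -/
noncomputable def flux (w R : ℝ → ℝ) (x : ℝ) : ℝ :=
  ∫ y in (0 : ℝ)..x, (w (R y) - multiplier w R)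

/-- The nonnegative `M`-Lipschitz functions that vanish at `0`. -/
def admissibleSlopes (M : ℝ) : Set C(ℝ, ℝ) :=
  {g | g 0 = 0 ∧ (∀ x, 0 ≤ g x) ∧ ∀ x y, |g x - g y| ≤ M * |x - y|}

theorem isCompact_admissibleSlopes (M : ℝ) : IsCompact (admissibleSlopes M) := by
  apply ArzelaAscoli.isCompact_of_equicontinuous
  · have himg : ContinuousMap.toFun '' admissibleSlopes M =
        (Set.univ.pi fun x : ℝ => Icc 0 (M * |x|)) ∩
          {f : ℝ → ℝ | ∀ x y, |f x - f y| ≤ M * |x - y|} := by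
      ext f
      constructor
      · rintro ⟨g, ⟨h0, hpos, hlip⟩, rfl⟩
        refine ⟨fun x _ => ⟨hpos x, ?_⟩, hlip⟩
        have := hlip x 0
        rw [h0, sub_zero, sub_zero, abs_of_nonneg (hpos x)] at this
        exact this
      · rintro ⟨hbd, hlip⟩
        have hbd' : ∀ x, f x ∈ Icc 0 (M * |x|) := fun x => hbd x trivial
        have hM : 0 ≤ M := by simpa using (hbd' 1).1.trans (hbd' 1).2
        have hc : Continuous f :=
          (LipschitzWith.of_dist_le_mul (K := ⟨M, hM⟩) fun x y => hlip x y).continuous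
        refine ⟨⟨f, hc⟩, ⟨?_, fun x => (hbd' x).1, hlip⟩, rfl⟩
        simpa using hbd' 0
    rw [himg]
    refine (isCompact_univ_pi fun x => isCompact_Icc).inter_right ?_
    simp only [ofPred_forall]
    exact isClosed_iInter fun x => isClosed_iInter fun y =>
      isClosed_le (by fun_prop) continuous_const
  · refine Metric.equicontinuous_of_continuity_modulus (fun s => M * s) ?_ _ ?_
    · have : Continuous fun s : ℝ => M * s := by fun_prop
      simpa using this.tendsto 0
    · exact fun x y g => g.2.2.2 x y

theorem continuous_densityOfSlope (c : ℝ) {g : ℝ → ℝ} (hg : Continuous g) :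
    Continuous (densityOfSlope c g) := by
  have : Continuous fun x => ∫ y in (0 : ℝ)..x, g y :=
    intervalIntegral.continuous_primitive (fun a b => hg.intervalIntegrable a b) 0
  unfold densityOfSlope
  fun_prop

theorem hasDerivAt_densityOfSlope (c : ℝ) {g : ℝ → ℝ} (hg : Continuous g) (x : ℝ) :
    HasDerivAt (densityOfSlope c g) (g x) x :=
  ((hg.integral_hasStrictDerivAt 0 x).hasDerivAt.const_add c).sub_const _

theorem integral_densityOfSlope (c : ℝ) {g : ℝ → ℝ} (hg : Continuous g) :
    ∫ x in (0 : ℝ)..1, densityOfSlope c g x = c := by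
  have : Continuous fun x => ∫ y in (0 : ℝ)..x, g y :=
    intervalIntegral.continuous_primitive (fun a b => hg.intervalIntegrable a b) 0
  unfold densityOfSlope
  rw [intervalIntegral.integral_sub, intervalIntegral.integral_add]
  · simp
  all_goals exact Continuous.intervalIntegrable (by fun_prop) _ _

theorem densityOfSlope_add_mul (c t : ℝ) {g d : ℝ → ℝ} (hg : Continuous g) (hd : Continuous d)
    (x : ℝ) : densityOfSlope c (fun y => g y + t * d y) x
      = densityOfSlope c g x + t * densityOfSlope 0 d x := by
  have hP : ∀ f : ℝ → ℝ, Continuous f → Continuous fun x => ∫ y in (0 : ℝ)..x, f y :=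
    fun f hf => intervalIntegral.continuous_primitive (fun a b => hf.intervalIntegrable a b) 0
  have h1 : ∀ z : ℝ, ∫ y in (0 : ℝ)..z, (g y + t * d y)
      = (∫ y in (0 : ℝ)..z, g y) + t * ∫ y in (0 : ℝ)..z, d y := fun z => by
    rw [intervalIntegral.integral_add (hg.intervalIntegrable _ _)
      (Continuous.intervalIntegrable (by fun_prop) _ _), intervalIntegral.integral_const_mul]
  have hPg := hP g hg
  have hPd := hP d hd
  unfold densityOfSlope
  simp only [h1]
  rw [intervalIntegral.integral_add (hPg.intervalIntegrable _ _)
    (Continuous.intervalIntegrable (by fun_prop) _ _), intervalIntegral.integral_const_mul]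
  ring

theorem continuous_slopeEnergy {W : ℝ → ℝ} (hW : Continuous W) (η c : ℝ) :
    Continuous fun g : C(ℝ, ℝ) => slopeEnergy W η c g := by
  have h1 : Continuous fun p : C(ℝ, ℝ) × ℝ => ∫ y in (0 : ℝ)..p.2, p.1 y :=
    intervalIntegral.continuous_parametric_intervalIntegral_of_continuous
      (f := fun (p : C(ℝ, ℝ) × ℝ) y => p.1 y) (by simp only [Function.uncurry_def]; fun_prop)
      continuous_snd
  have h2 : Continuous fun g : C(ℝ, ℝ) => ∫ z in (0 : ℝ)..1, ∫ y in (0 : ℝ)..z, g y :=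
    intervalIntegral.continuous_parametric_intervalIntegral_of_continuous'
      (f := fun (g : C(ℝ, ℝ)) z => ∫ y in (0 : ℝ)..z, g y) h1 0 1
  refine intervalIntegral.continuous_parametric_intervalIntegral_of_continuous'
    (f := fun (g : C(ℝ, ℝ)) x => η / 2 * g x ^ 2 + W (densityOfSlope c g x)) ?_ 0 1
  have h3 : Continuous fun p : C(ℝ, ℝ) × ℝ => densityOfSlope c p.1 p.2 :=
    (h1.const_add c).sub (h2.comp continuous_fst)
  simp only [Function.uncurry_def]
  fun_prop

section Flux

variable {w R : ℝ → ℝ} {B : ℝ}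

theorem hasDerivAt_flux (hw : Continuous w) (hR : Continuous R) (x : ℝ) :
    HasDerivAt (flux w R) (w (R x) - multiplier w R) x :=
  Continuous.integral_hasStrictDerivAt (f := fun y => w (R y) - multiplier w R)
    (by fun_prop) 0 x |>.hasDerivAt

theorem continuous_flux (hw : Continuous w) (hR : Continuous R) : Continuous (flux w R) :=
  continuous_iff_continuousAt.2 fun x => (hasDerivAt_flux hw hR x).continuousAt

theorem flux_zero : flux w R 0 = 0 := intervalIntegral.integral_same

theorem flux_one (hw : Continuous w) (hR : Continuous R) : flux w R 1 = 0 := by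
  unfold flux
  rw [intervalIntegral.integral_sub (Continuous.intervalIntegrable (by fun_prop) _ _)
    (continuous_const.intervalIntegrable _ _)]
  simp [multiplier]

theorem abs_multiplier_le (hb : ∀ r, |w r| ≤ B) : |multiplier w R| ≤ B := by
  simpa [multiplier] using intervalIntegral.norm_integral_le_of_norm_le_const (a := (0 : ℝ))
    (b := 1) (f := fun z => w (R z)) (C := B) fun x _ => hb (R x)

theorem abs_flux_sub_le (hw : Continuous w) (hR : Continuous R) (hb : ∀ r, |w r| ≤ B) (x y : ℝ) :
    |flux w R x - flux w R y| ≤ 2 * B * |x - y| := by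
  refine Convex.norm_image_sub_le_of_norm_hasDerivWithin_le (s := univ)
    (fun z _ => (hasDerivAt_flux hw hR z).hasDerivWithinAt) (fun z _ => ?_) convex_univ
    (mem_univ y) (mem_univ x)
  have h1 := hb (R z)
  have h2 := abs_multiplier_le (R := R) hb
  exact (norm_sub_le _ _).trans (by simp only [Real.norm_eq_abs]; linarith)

/-- The derivative of the potential energy is represented by the flux. -/
theorem integral_deriv_mul_densityOfSlope (hw : Continuous w) (hR : Continuous R) {d : ℝ → ℝ}
    (hd : Continuous d) :
    ∫ x in (0 : ℝ)..1, w (R x) * densityOfSlope 0 d x = - ∫ x in (0 : ℝ)..1, flux w R x * d x := by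
  have hD := continuous_densityOfSlope 0 hd
  have hparts := intervalIntegral.integral_mul_deriv_eq_deriv_mul (a := (0 : ℝ)) (b := 1)
    (fun x _ => hasDerivAt_flux hw hR x) (fun x _ => hasDerivAt_densityOfSlope 0 hd x)
    (Continuous.intervalIntegrable (by fun_prop) _ _) (hd.intervalIntegrable _ _)
  rw [flux_one hw hR, flux_zero] at hparts
  have hsplit : ∫ x in (0 : ℝ)..1, (w (R x) - multiplier w R) * densityOfSlope 0 d x
      = ∫ x in (0 : ℝ)..1, w (R x) * densityOfSlope 0 d x := by
    simp only [sub_mul]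
    rw [intervalIntegral.integral_sub (Continuous.intervalIntegrable (by fun_prop) _ _)
      (Continuous.intervalIntegrable (by fun_prop) _ _), intervalIntegral.integral_const_mul,
      integral_densityOfSlope 0 hd]
    simp
  rw [hparts, hsplit]
  ring

end Flux

/-- The first variation of the energy in the direction `d`. -/
theorem hasDerivAt_slopeEnergy {W w : ℝ → ℝ} {a b B : ℝ} (h : IsDoubleWell W w a b B) (η c : ℝ)
    {g d : ℝ → ℝ} (hg : Continuous g) (hd : Continuous d) :
    HasDerivAt (fun t => slopeEnergy W η c fun y => g y + t * d y)
      (∫ x in (0 : ℝ)..1, (η * g x - flux w (densityOfSlope c g) x) * d x) 0 := by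
  have hR := continuous_densityOfSlope c hg
  have hD := continuous_densityOfSlope 0 hd
  have hW := h.continuous
  have hw := h.continuous_deriv
  have hQ := continuous_flux hw hR
  set R := densityOfSlope c g with hRdef
  set D := densityOfSlope 0 d with hDdef
  have key := (intervalIntegral.hasDerivAt_integral_of_dominated_loc_of_deriv_le
    (μ := MeasureTheory.volume) (a := (0 : ℝ)) (b := 1) (x₀ := (0 : ℝ)) (s := Metric.ball 0 1)
    (F := fun t x => η / 2 * (g x + t * d x) ^ 2 + W (R x + t * D x))
    (F' := fun t x => η * (g x + t * d x) * d x + w (R x + t * D x) * D x)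
    (bound := fun x => |η| * (|g x| + |d x|) * |d x| + B * |D x|)
    (Metric.ball_mem_nhds 0 one_pos)
    (Eventually.of_forall fun t => Continuous.aestronglyMeasurable (by fun_prop))
    (Continuous.intervalIntegrable (by fun_prop) _ _)
    (Continuous.aestronglyMeasurable (by fun_prop))
    (Eventually.of_forall fun x _ t ht => ?_)
    (Continuous.intervalIntegrable (by fun_prop) _ _)
    (Eventually.of_forall fun x _ t ht => ?_)).2
  · refine (key.congr_deriv ?_).congr_of_eventuallyEq (Eventually.of_forall fun t => ?_)
    · simp only [zero_mul, add_zero, sub_mul]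
      rw [intervalIntegral.integral_add (Continuous.intervalIntegrable (by fun_prop) _ _)
        (Continuous.intervalIntegrable (by fun_prop) _ _),
        intervalIntegral.integral_sub (Continuous.intervalIntegrable (by fun_prop) _ _)
        (Continuous.intervalIntegrable (by fun_prop) _ _),
        integral_deriv_mul_densityOfSlope hw hR hd, sub_eq_add_neg]
    · simp only [slopeEnergy, densityOfSlope_add_mul c t hg hd, ← hRdef, ← hDdef]
  · have ht' : |t| ≤ 1 := by simpa [Real.dist_eq] using (Metric.mem_ball.1 ht).le
    have h1 : |g x + t * d x| ≤ |g x| + |d x| := by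
      refine (abs_add_le _ _).trans (add_le_add_right ?_ _)
      rw [abs_mul]
      exact mul_le_of_le_one_left (abs_nonneg _) ht'
    refine (norm_add_le _ _).trans ?_
    simp only [Real.norm_eq_abs, abs_mul]
    gcongr
    exact h.bound _
  · have h1 : HasDerivAt (fun s => g x + s * d x) (d x) t := by
      simpa using ((hasDerivAt_id t).mul_const (d x)).const_add (g x)
    have h2 : HasDerivAt (fun s => R x + s * D x) (D x) t := by
      simpa using ((hasDerivAt_id t).mul_const (D x)).const_add (R x)
    refine (((h1.pow 2).const_mul (η / 2)).add ((h.hasDerivAt _).comp t h2)).congr_deriv ?_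
    simp only [Nat.cast_ofNat]
    ring

theorem exists_isMinOn_slopeEnergy {W : ℝ → ℝ} (hW : Continuous W) (η c : ℝ) {M : ℝ}
    (hM : 0 ≤ M) :
    ∃ g ∈ admissibleSlopes M, IsMinOn (fun g : C(ℝ, ℝ) => slopeEnergy W η c g)
      (admissibleSlopes M) g :=
  (isCompact_admissibleSlopes M).exists_isMinOn
    ⟨0, by simp, by simp, fun x y => by simpa using mul_nonneg hM (abs_nonneg _)⟩
    (continuous_slopeEnergy hW η c).continuousOn

/-- A minimiser `g` among the admissible slopes satisfies `η g = Q⁺` on `[0, 1]`, where `Q` is the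
flux: the Lipschitz bound is so large that `Q⁺ / η` is admissible, and the first variation of the
energy in the direction `Q⁺ / η - g` is at most `- η ∫ (Q⁺ / η - g)²`. -/
theorem eq_max_flux_of_isMinOn {W w : ℝ → ℝ} {a b B : ℝ} (h : IsDoubleWell W w a b B) {η c : ℝ}
    (hη : 0 < η) {g : C(ℝ, ℝ)} (hg : g ∈ admissibleSlopes (2 * B / η))
    (hmin : IsMinOn (fun g : C(ℝ, ℝ) => slopeEnergy W η c g) (admissibleSlopes (2 * B / η)) g) :
    ∀ x ∈ Icc (0 : ℝ) 1, η * g x = max (flux w (densityOfSlope c g) x) 0 := by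
  have hR := continuous_densityOfSlope c g.continuous
  have hQ := continuous_flux h.continuous_deriv hR
  set Q := flux w (densityOfSlope c g) with hQdef
  have hpc : Continuous fun x => max (Q x) 0 / η - g x := by fun_prop
  have hder := hasDerivAt_slopeEnergy h η c g.continuous hpc
  rw [← hQdef] at hder
  -- The competitors `g + t (Q⁺ / η - g)` are admissible by convexity.
  have hnonneg : 0 ≤ ∫ x in (0 : ℝ)..1, (η * g x - Q x) * (max (Q x) 0 / η - g x) := by
    have hslope := hasDerivWithinAt_iff_tendsto_slope.1 (hder.hasDerivWithinAt (s := Ioi 0))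
    rw [Set.sdiff_singleton_eq_self (by simp)] at hslope
    refine ge_of_tendsto hslope ?_
    have hev : ∀ᶠ t : ℝ in 𝓝[>] 0, t < 1 := nhdsWithin_le_nhds (Iio_mem_nhds one_pos)
    filter_upwards [hev, self_mem_nhdsWithin] with t ht1 ht0
    have ht0 : 0 < t := ht0
    have hpos : ∀ x, 0 ≤ max (Q x) 0 / η := fun x => div_nonneg (le_max_right _ _) hη.le
    have hmem : (⟨fun x => g x + t * (max (Q x) 0 / η - g x), by fun_prop⟩ : C(ℝ, ℝ))
        ∈ admissibleSlopes (2 * B / η) := by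
      refine ⟨?_, fun x => ?_, fun x y => ?_⟩
      · simp [hg.1, hQdef, flux_zero]
      · have h1 := mul_nonneg (sub_nonneg.2 ht1.le) (hg.2.1 x)
        have h2 := mul_nonneg ht0.le (hpos x)
        simp only [ContinuousMap.coe_mk]
        linarith
      · have h1 := hg.2.2 x y
        have h2 : |max (Q x) 0 / η - max (Q y) 0 / η| ≤ 2 * B / η * |x - y| := by
          rw [← sub_div, abs_div, abs_of_pos hη, div_mul_eq_mul_div]
          gcongr
          exact (abs_max_sub_max_le_abs _ _ _).trans
            (abs_flux_sub_le h.continuous_deriv hR h.bound x y)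
        simp only [ContinuousMap.coe_mk]
        calc |g x + t * (max (Q x) 0 / η - g x) - (g y + t * (max (Q y) 0 / η - g y))|
            = |(1 - t) * (g x - g y) + t * (max (Q x) 0 / η - max (Q y) 0 / η)| := by ring_nf
          _ ≤ (1 - t) * |g x - g y| + t * |max (Q x) 0 / η - max (Q y) 0 / η| := by
              refine (abs_add_le _ _).trans_eq ?_
              rw [abs_mul, abs_mul, abs_of_pos ht0, abs_of_nonneg (sub_nonneg.2 ht1.le)]
          _ ≤ (1 - t) * (2 * B / η * |x - y|) + t * (2 * B / η * |x - y|) := by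
              have := sub_nonneg.2 ht1.le
              gcongr
          _ = 2 * B / η * |x - y| := by ring
    have hle := hmin hmem
    simp only [mem_ofPred_eq, ContinuousMap.coe_mk] at hle
    rw [slope_def_field]
    simp only [zero_mul, add_zero, sub_zero]
    exact div_nonneg (sub_nonneg.2 hle) ht0.le
  have hpt : ∀ x, (η * g x - Q x) * (max (Q x) 0 / η - g x)
      ≤ -(η * (max (Q x) 0 / η - g x) ^ 2) := by
    intro x
    rcases le_total 0 (Q x) with hx | hx
    · rw [max_eq_left hx]
      refine le_of_eq ?_
      field_simp
      ring
    · rw [max_eq_right hx]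
      have := mul_nonneg (neg_nonneg.2 hx) (hg.2.1 x)
      simp only [zero_div, zero_sub, neg_sq]
      linarith
  have hzero : ∀ x ∈ Icc (0 : ℝ) 1, η * (max (Q x) 0 / η - g x) ^ 2 = 0 := by
    by_contra! hne
    obtain ⟨x, hx, hx0⟩ := hne
    have hcont : Continuous fun x => η * (max (Q x) 0 / η - g x) ^ 2 := by fun_prop
    have hpos := intervalIntegral.integral_pos one_pos hcont.continuousOn
      (fun x _ => by positivity) ⟨x, hx, lt_of_le_of_ne (by positivity) (Ne.symm hx0)⟩
    have hmono := intervalIntegral.integral_mono_on (μ := MeasureTheory.volume) zero_le_one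
      (Continuous.intervalIntegrable (by fun_prop) _ _)
      (Continuous.intervalIntegrable (by fun_prop) _ _) fun x _ => hpt x
    rw [intervalIntegral.integral_neg] at hmono
    linarith
  intro x hx
  have h1 := hzero x hx
  rw [mul_eq_zero, or_iff_right hη.ne', sq_eq_zero_iff, sub_eq_zero] at h1
  rw [← h1]
  field_simp

/-! ### Monotone transition profiles -/

/-- The flux is nonnegative. At a negative minimum `x₀` of the flux its derivative `w(R) - λ`
vanishes. Since `R` does not move where the flux is negative, the derivative stays zero down to the
last point before `x₀` at which the flux is nonnegative, so the flux is constant in between. -/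
theorem flux_nonneg {w R g : ℝ → ℝ} {η : ℝ} (hη : 0 < η) (hw : Continuous w)
    (hR : ∀ x, HasDerivAt R (g x) x)
    (hg : ∀ x ∈ Icc (0 : ℝ) 1, η * g x = max (flux w R x) 0) :
    ∀ x ∈ Icc (0 : ℝ) 1, 0 ≤ flux w R x := by
  have hRc : Continuous R := continuous_iff_continuousAt.2 fun x => (hR x).continuousAt
  have hQ := continuous_flux hw hRc
  obtain ⟨x₀, hx₀, hmin⟩ :=
    isCompact_Icc.exists_isMinOn (nonempty_Icc.2 zero_le_one) hQ.continuousOn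
  suffices h : 0 ≤ flux w R x₀ from fun x hx => h.trans (hmin hx)
  by_contra! hneg
  have h0 : 0 < x₀ := lt_of_le_of_ne hx₀.1 fun h => by rw [← h, flux_zero] at hneg; exact hneg.false
  have h1 : x₀ < 1 := lt_of_le_of_ne hx₀.2 fun h => by
    rw [h, flux_one hw hRc] at hneg; exact hneg.false
  have hcrit : w (R x₀) - multiplier w R = 0 :=
    (hmin.isLocalMin (Icc_mem_nhds h0 h1)).hasDerivAt_eq_zero (hasDerivAt_flux hw hRc x₀)
  obtain ⟨x₁, ⟨hx₁, hQ₁⟩, hgreatest⟩ :=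
    (isCompact_Icc.inter_right (isClosed_le continuous_const hQ) :
      IsCompact (Icc 0 x₀ ∩ {x | 0 ≤ flux w R x})).exists_isGreatest
      ⟨0, ⟨le_rfl, h0.le⟩, flux_zero.ge⟩
  have hx₁₀ : x₁ < x₀ := lt_of_le_of_ne hx₁.2 fun h => by
    rw [h] at hQ₁; exact hneg.not_ge hQ₁
  have hlt : ∀ y, x₁ < y → y < x₀ → g y = 0 := by
    intro y hy hy'
    have hy01 : y ∈ Icc (0 : ℝ) 1 := ⟨hx₁.1.trans hy.le, hy'.le.trans h1.le⟩
    have hQy : flux w R y < 0 := by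
      by_contra! hge
      exact hy.not_ge (hgreatest ⟨⟨hy01.1, hy'.le⟩, hge⟩)
    have := hg y hy01
    rw [max_eq_right hQy.le] at this
    exact (mul_eq_zero.1 this).resolve_left hη.ne'
  have hconst : ∀ y, x₁ < y → y < x₀ → R y = R x₀ := by
    intro y hy hy'
    obtain ⟨ξ, hξ, he⟩ := exists_hasDerivAt_eq_slope R g hy' hRc.continuousOn fun x _ => hR x
    rw [hlt ξ (hy.trans hξ.1) hξ.2, eq_comm, div_eq_zero_iff, or_iff_left (sub_pos.2 hy').ne',
      sub_eq_zero] at he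
    exact he.symm
  obtain ⟨ξ, hξ, he⟩ := exists_hasDerivAt_eq_slope (flux w R) _ hx₁₀ hQ.continuousOn
    fun x _ => hasDerivAt_flux hw hRc x
  rw [hconst ξ hξ.1 hξ.2, hcrit, eq_comm, div_eq_zero_iff, or_iff_left (sub_pos.2 hx₁₀).ne',
    sub_eq_zero] at he
  exact hneg.not_ge (he ▸ hQ₁)

/-- A monotone solution on `[0, 1]`, with values in `[a, b]` and mean value `c`, of the Neumann
problem `η R'' = w(R) - λ`, `R'(0) = R'(1) = 0`, where `λ` is the mean value of `w(R)`. The equation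
is stated in its integrated form `η R' = flux w R`. -/
structure IsTransitionProfile (w : ℝ → ℝ) (a b c η : ℝ) (R : ℝ → ℝ) : Prop where
  continuous : Continuous R
  hasDerivAt : ∀ x ∈ Icc (0 : ℝ) 1, HasDerivAt R (flux w R x / η) x
  monotoneOn : MonotoneOn R (Icc 0 1)
  mem : ∀ x ∈ Icc (0 : ℝ) 1, R x ∈ Icc a b
  mean : ∫ x in (0 : ℝ)..1, R x = c

/-- The first integral of the profile equation. -/
theorem flux_sq_eq {W w R : ℝ → ℝ} {a b B η : ℝ} (h : IsDoubleWell W w a b B) (hη : 0 < η)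
    (hRc : Continuous R) (hR : ∀ x ∈ Icc (0 : ℝ) 1, HasDerivAt R (flux w R x / η) x) :
    ∀ x ∈ Icc (0 : ℝ) 1, flux w R x ^ 2 / (2 * η)
      = W (R x) - W (R 0) - multiplier w R * (R x - R 0) := by
  intro x hx
  have hd : ∀ y ∈ Icc (0 : ℝ) 1, HasDerivAt (fun y => flux w R y ^ 2 / (2 * η)
      - (W (R y) - W (R 0) - multiplier w R * (R y - R 0))) 0 y := by
    intro y hy
    have h1 := ((hasDerivAt_flux h.continuous_deriv hRc y).pow 2).div_const (2 * η)
    have h2 := (((h.hasDerivAt (R y)).comp y (hR y hy)).sub_const (W (R 0))).sub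
      (((hR y hy).sub_const (R 0)).const_mul (multiplier w R))
    refine (h1.sub h2).congr_deriv ?_
    simp only [Nat.cast_ofNat]
    field_simp
    ring
  have := constant_of_has_deriv_right_zero
    (fun y hy => (hd y hy).continuousAt.continuousWithinAt)
    (fun y hy => (hd y (Ico_subset_Icc_self hy)).hasDerivWithinAt) x hx
  simp only [flux_zero, sub_self, mul_zero, ne_eq, OfNat.ofNat_ne_zero, not_false_eq_true,
    zero_pow, zero_div] at this
  linarith

/-- Values of a profile stay between the wells. By the first integral the chord of `W` over the
range of `R` lies below `W`; it is nonnegative at both ends, and positive at an end that lies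
outside `[a, b]`, so it cannot be `≤ 0` at a well in between. -/
theorem mem_Icc_of_first_integral {W w R : ℝ → ℝ} {a b B η c : ℝ} (h : IsDoubleWell W w a b B)
    (hη : 0 < η) (hc : c ∈ Ioo a b) (hRc : Continuous R)
    (hR : ∀ x ∈ Icc (0 : ℝ) 1, HasDerivAt R (flux w R x / η) x) (hmono : MonotoneOn R (Icc 0 1))
    (hmean : ∫ x in (0 : ℝ)..1, R x = c) :
    ∀ x ∈ Icc (0 : ℝ) 1, R x ∈ Icc a b := by
  have m0 : (0 : ℝ) ∈ Icc (0 : ℝ) 1 := ⟨le_rfl, zero_le_one⟩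
  have m1 : (1 : ℝ) ∈ Icc (0 : ℝ) 1 := ⟨zero_le_one, le_rfl⟩
  have hlo : R 0 ≤ c := by
    have := intervalIntegral.integral_mono_on (μ := MeasureTheory.volume) (f := fun _ => R 0)
      zero_le_one (continuous_const.intervalIntegrable _ _)
      (hRc.intervalIntegrable _ _) fun x hx => hmono m0 hx hx.1
    simpa [hmean] using this
  have hhi : c ≤ R 1 := by
    have := intervalIntegral.integral_mono_on (μ := MeasureTheory.volume) (g := fun _ => R 1)
      zero_le_one (hRc.intervalIntegrable _ _)
      (continuous_const.intervalIntegrable _ _) fun x hx => hmono hx m1 hx.2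
    simpa [hmean] using this
  have hchord : ∀ r ∈ Icc (R 0) (R 1), W (R 0) + multiplier w R * (r - R 0) ≤ W r := by
    intro r hr
    obtain ⟨x, hx, rfl⟩ := intermediate_value_Icc zero_le_one hRc.continuousOn hr
    have := flux_sq_eq h hη hRc hR x hx
    have h2 : 0 ≤ flux w R x ^ 2 / (2 * η) := by positivity
    linarith
  have hend : W (R 0) + multiplier w R * (R 1 - R 0) = W (R 1) := by
    have := flux_sq_eq h hη hRc hR 1 m1
    rw [flux_one h.continuous_deriv hRc] at this
    simp only [ne_eq, OfNat.ofNat_ne_zero, not_false_eq_true, zero_pow, zero_div] at this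
    linarith
  have hb : R 1 ≤ b := by
    by_contra! hlt
    have h1 := hchord b ⟨hlo.trans hc.2.le, hlt.le⟩
    have h2 := h.pos (R 1) (h.lt.trans hlt).ne' hlt.ne'
    have h3 := h.nonneg (R 0)
    rw [h.right] at h1
    have h4 : 0 < b - R 0 := by linarith [hc.2]
    have h5 : 0 < R 1 - b := sub_pos.2 hlt
    have h6 := mul_pos h2 h4
    have h7 := mul_nonneg h3 h5.le
    rw [← hend] at h6
    nlinarith
  have ha : a ≤ R 0 := by
    by_contra! hlt
    have h1 := hchord a ⟨hlt.le, hc.1.le.trans hhi⟩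
    have h2 := h.pos (R 0) hlt.ne (hlt.trans h.lt).ne
    have h3 := h.nonneg (R 1)
    rw [h.left] at h1
    have h4 : 0 < R 1 - a := by linarith [hc.1]
    have h5 : 0 < a - R 0 := sub_pos.2 hlt
    have h6 := mul_pos h2 h4
    have h7 := mul_nonneg h3 h5.le
    rw [← hend] at h7
    nlinarith
  exact fun x hx => ⟨ha.trans (hmono m0 hx hx.1), (hmono hx m1 hx.2).trans hb⟩

/-- Transition profiles exist for every `η > 0`, with potential energy below that of all admissible
competitors. -/
theorem exists_isTransitionProfile {W w : ℝ → ℝ} {a b B c η : ℝ} (h : IsDoubleWell W w a b B)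
    (hc : c ∈ Ioo a b) (hη : 0 < η) :
    ∃ R, IsTransitionProfile w a b c η R ∧ ∀ g ∈ admissibleSlopes (2 * B / η),
      ∫ x in (0 : ℝ)..1, W (R x) ≤ slopeEnergy W η c g := by
  have hB := h.bound_pos
  obtain ⟨g, hg, hmin⟩ := exists_isMinOn_slopeEnergy h.continuous η c
    (M := 2 * B / η) (by positivity)
  have hRc := continuous_densityOfSlope c g.continuous
  have hR := hasDerivAt_densityOfSlope c g.continuous
  have heq := eq_max_flux_of_isMinOn h hη hg hmin
  have hpos := flux_nonneg hη h.continuous_deriv hR heq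
  have hR' : ∀ x ∈ Icc (0 : ℝ) 1, HasDerivAt (densityOfSlope c g)
      (flux w (densityOfSlope c g) x / η) x := by
    intro x hx
    have := heq x hx
    rw [max_eq_left (hpos x hx)] at this
    refine (hR x).congr_deriv ?_
    rw [← this]
    field_simp
  have hmono : MonotoneOn (densityOfSlope c g) (Icc 0 1) :=
    (monotone_of_hasDerivAt_nonneg hR hg.2.1).monotoneOn _
  have hmean := integral_densityOfSlope c g.continuous
  refine ⟨_, ⟨hRc, hR', hmono, mem_Icc_of_first_integral h hη hc hRc hR' hmono hmean, hmean⟩, ?_⟩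
  intro f hf
  refine le_trans ?_ (hmin hf)
  have hW := h.continuous
  refine intervalIntegral.integral_mono_on zero_le_one
    (Continuous.intervalIntegrable (by fun_prop) _ _)
    (Continuous.intervalIntegrable (by fun_prop) _ _) fun x _ => ?_
  have : 0 ≤ η / 2 * g x ^ 2 := by positivity
  linarith

/-! ### The sharp interface limit -/

theorem integral_ite_le {f g : ℝ → ℝ} {θ : ℝ} (hf : Continuous f) (hg : Continuous g)
    (hθ : θ ∈ Icc (0 : ℝ) 1) :
    IntervalIntegrable (fun x => if x ≤ θ then f x else g x) MeasureTheory.volume 0 1 ∧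
      ∫ x in (0 : ℝ)..1, (if x ≤ θ then f x else g x)
        = (∫ x in (0 : ℝ)..θ, f x) + ∫ x in θ..1, g x := by
  have e1 : EqOn (fun x => if x ≤ θ then f x else g x) f (uIoc 0 θ) := fun x hx => by
    rw [uIoc_of_le hθ.1] at hx
    exact if_pos hx.2
  have e2 : EqOn (fun x => if x ≤ θ then f x else g x) g (uIoc θ 1) := fun x hx => by
    rw [uIoc_of_le hθ.2] at hx
    exact if_neg hx.1.not_ge
  have i1 := (intervalIntegrable_congr (μ := MeasureTheory.volume) e1).2
    (hf.intervalIntegrable 0 θ)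
  have i2 := (intervalIntegrable_congr (μ := MeasureTheory.volume) e2).2
    (hg.intervalIntegrable θ 1)
  refine ⟨i1.trans i2, ?_⟩
  rw [← intervalIntegral.integral_add_adjacent_intervals i1 i2,
    intervalIntegral.integral_congr_ae (Eventually.of_forall fun x hx => e1 hx),
    intervalIntegral.integral_congr_ae (Eventually.of_forall fun x hx => e2 hx)]


/-- The potential energy of smooth slopes concentrating at the point `(b - c) / (b - a)` becomes
arbitrarily small. -/
theorem exists_admissibleSlope_potential_lt {W : ℝ → ℝ} {a b c : ℝ} (hW : Continuous W)
    (ha : W a = 0) (hb : W b = 0) (hc : c ∈ Ioo a b) {κ : ℝ} (hκ : 0 < κ) :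
    ∃ M, ∃ g ∈ admissibleSlopes M, ∫ x in (0 : ℝ)..1, W (densityOfSlope c g x) < κ := by
  have hab : 0 < b - a := by linarith [hc.1, hc.2]
  set θ := (b - c) / (b - a) with hθ
  have hθ0 : 0 < θ := div_pos (by linarith [hc.2]) hab
  have hθ1 : θ < 1 := (div_lt_one hab).2 (by linarith [hc.1])
  set s := Real.smoothTransition
  have hs : ContDiff ℝ 2 s := Real.smoothTransition.contDiff (n := 2)
  have hs' : ContDiff ℝ 1 (deriv s) := by
    have : ContDiff ℝ (1 + 1) s := by norm_num; exact hs
    exact (contDiff_succ_iff_deriv.1 this).2.2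
  have hs'0 : ∀ x ≤ 0, deriv s x = 0 := by
    intro x hx
    refine IsLocalMin.deriv_eq_zero (Eventually.of_forall fun y => ?_)
    simpa only [s, Real.smoothTransition.zero_of_nonpos hx] using Real.smoothTransition.nonneg y
  have hsupp : HasCompactSupport (deriv s) := by
    refine HasCompactSupport.intro (K := Icc 0 1) isCompact_Icc fun x hx => ?_
    rcases le_or_gt x 0 with h0 | h0
    · exact hs'0 x h0
    · have h1 : 1 < x := by by_contra! h1; exact hx ⟨h0.le, h1⟩
      have : s =ᶠ[𝓝 x] fun _ => 1 := by
        filter_upwards [Ioi_mem_nhds h1] with y hy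
        exact Real.smoothTransition.one_of_one_le (le_of_lt hy)
      rw [this.deriv_eq, deriv_const]
  obtain ⟨C, hC⟩ := hs'.lipschitzWith_of_hasCompactSupport hsupp one_ne_zero
  have hs'c := hs'.continuous
  -- The slope of a transition layer of width `1 / n` at `θ`.
  let g : ℕ → C(ℝ, ℝ) := fun n => ⟨fun x => (b - a) * n * deriv s (n * (x - θ)), by fun_prop⟩
  have hgmem : ∀ n : ℕ, g n ∈ admissibleSlopes ((b - a) * n * (C * n)) := by
    intro n
    refine ⟨?_, fun x => ?_, fun x y => ?_⟩
    · have : (n : ℝ) * (0 - θ) ≤ 0 :=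
        mul_nonpos_of_nonneg_of_nonpos (Nat.cast_nonneg n) (by linarith)
      simp only [g, ContinuousMap.coe_mk, hs'0 _ this, mul_zero]
    · have : 0 ≤ deriv s (n * (x - θ)) := Real.smoothTransition.monotone.deriv_nonneg
      simp only [g, ContinuousMap.coe_mk]
      positivity
    · have := hC.dist_le_mul (n * (x - θ)) (n * (y - θ))
      rw [Real.dist_eq, Real.dist_eq, ← mul_sub, abs_mul, Nat.abs_cast,
        sub_sub_sub_cancel_right] at this
      simp only [g, ContinuousMap.coe_mk]
      rw [← mul_sub, abs_mul, abs_of_nonneg (by positivity : 0 ≤ (b - a) * (n : ℝ)), mul_assoc,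
        mul_assoc (b - a), mul_assoc, mul_assoc]
      gcongr
      simpa only [mul_assoc] using this
  have hprim : ∀ (n : ℕ) (x : ℝ), ∫ y in (0 : ℝ)..x, g n y = (b - a) * s (n * (x - θ)) := by
    intro n x
    have hd : ∀ y ∈ uIcc 0 x, HasDerivAt (fun y => (b - a) * s (n * (y - θ))) (g n y) y := by
      intro y _
      have h1 : HasDerivAt (fun y : ℝ => (n : ℝ) * (y - θ)) n y := by
        simpa using ((hasDerivAt_id y).sub_const θ).const_mul (n : ℝ)
      have h2 := (hs.differentiable two_ne_zero (n * (y - θ))).hasDerivAt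
      refine ((h2.comp y h1).const_mul (b - a)).congr_deriv ?_
      simp only [g, ContinuousMap.coe_mk]
      ring
    rw [intervalIntegral.integral_eq_sub_of_hasDerivAt hd
      ((g n).continuous.intervalIntegrable _ _)]
    have : (n : ℝ) * (0 - θ) ≤ 0 :=
      mul_nonpos_of_nonneg_of_nonpos (Nat.cast_nonneg n) (by linarith)
    simp only [s, Real.smoothTransition.zero_of_nonpos this, mul_zero, sub_zero]
  have hlim : ∀ x, Tendsto (fun n : ℕ => (b - a) * s (n * (x - θ))) atTop
      (𝓝 (if x ≤ θ then 0 else b - a)) := by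
    intro x
    split_ifs with hx
    · refine tendsto_const_nhds.congr fun n => ?_
      simp only [s, Real.smoothTransition.zero_of_nonpos
        (mul_nonpos_of_nonneg_of_nonpos (Nat.cast_nonneg n) (sub_nonpos.2 hx)), mul_zero]
    · have hx' : 0 < x - θ := sub_pos.2 (not_le.1 hx)
      refine tendsto_const_nhds.congr' ?_
      have := (tendsto_natCast_atTop_atTop (R := ℝ)).atTop_mul_const hx'
      filter_upwards [this.eventually_ge_atTop 1] with n hn
      simp only [s, Real.smoothTransition.one_of_one_le hn, mul_one]
  have hbd : ∀ (n : ℕ) (x : ℝ), |(b - a) * s (n * (x - θ))| ≤ b - a := fun n x => by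
    rw [abs_of_nonneg (mul_nonneg hab.le (Real.smoothTransition.nonneg _))]
    exact mul_le_of_le_one_right hab.le (Real.smoothTransition.le_one _)
  have hsc := hs.continuous
  have hmean : Tendsto (fun n : ℕ => ∫ x in (0 : ℝ)..1, (b - a) * s (n * (x - θ))) atTop
      (𝓝 (c - a)) := by
    have hval : ∫ x in (0 : ℝ)..1, (if x ≤ θ then 0 else b - a) = c - a := by
      rw [(integral_ite_le continuous_const continuous_const ⟨hθ0.le, hθ1.le⟩).2, hθ]
      simp only [intervalIntegral.integral_const, smul_eq_mul]
      field_simp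
      ring
    rw [← hval]
    exact intervalIntegral.tendsto_integral_filter_of_dominated_convergence (fun _ => b - a)
      (Eventually.of_forall fun n => Continuous.aestronglyMeasurable (by fun_prop))
      (Eventually.of_forall fun n => Eventually.of_forall fun x _ => hbd n x)
      (continuous_const.intervalIntegrable _ _) (Eventually.of_forall fun x _ => hlim x)
  have hdens : ∀ (n : ℕ) (x : ℝ), densityOfSlope c (g n) x = c + (b - a) * s (n * (x - θ))
      - ∫ x in (0 : ℝ)..1, (b - a) * s (n * (x - θ)) := fun n x => by
    simp only [densityOfSlope, hprim]
  have hdlim : ∀ x, Tendsto (fun n => densityOfSlope c (g n) x) atTop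
      (𝓝 (if x ≤ θ then a else b)) := by
    intro x
    simp only [hdens]
    convert ((hlim x).const_add c).sub hmean using 2
    split_ifs <;> ring
  have hWlim : ∀ x, Tendsto (fun n => W (densityOfSlope c (g n) x)) atTop (𝓝 0) := by
    intro x
    have h0 : W (if x ≤ θ then a else b) = 0 := by split_ifs <;> assumption
    exact h0 ▸ (hW.tendsto _).comp (hdlim x)
  have hdmem : ∀ (n : ℕ) (x : ℝ), densityOfSlope c (g n) x ∈ Icc (c - (b - a)) (c + (b - a)) := by
    intro n x
    have h0 : ∀ x, 0 ≤ (b - a) * s (n * (x - θ)) := fun x =>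
      mul_nonneg hab.le (Real.smoothTransition.nonneg _)
    have h1 : ∀ x, (b - a) * s (n * (x - θ)) ≤ b - a := fun x => (le_abs_self _).trans (hbd n x)
    have h2 : 0 ≤ ∫ x in (0 : ℝ)..1, (b - a) * s (n * (x - θ)) :=
      intervalIntegral.integral_nonneg zero_le_one fun x _ => h0 x
    have h3 : ∫ x in (0 : ℝ)..1, (b - a) * s (n * (x - θ)) ≤ b - a := by
      have := intervalIntegral.integral_mono_on (μ := MeasureTheory.volume)
        (g := fun _ => b - a) zero_le_one
        (Continuous.intervalIntegrable (u := fun x => (b - a) * s (n * (x - θ))) (by fun_prop) 0 1)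
        (continuous_const.intervalIntegrable _ _) fun x _ => h1 x
      simpa using this
    rw [hdens]
    exact ⟨by linarith [h0 x], by linarith [h1 x]⟩
  obtain ⟨K, hK⟩ := isCompact_Icc.exists_bound_of_continuousOn
    (hW.continuousOn (s := Icc (c - (b - a)) (c + (b - a))))
  have hint : Tendsto (fun n => ∫ x in (0 : ℝ)..1, W (densityOfSlope c (g n) x)) atTop
      (𝓝 (∫ x in (0 : ℝ)..1, (0 : ℝ))) :=
    intervalIntegral.tendsto_integral_filter_of_dominated_convergence (fun _ => K)
      (Eventually.of_forall fun n => Continuous.aestronglyMeasurable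
        (hW.comp (continuous_densityOfSlope c (g n).continuous)))
      (Eventually.of_forall fun n => Eventually.of_forall fun x _ => hK _ (hdmem n x))
      (continuous_const.intervalIntegrable _ _) (Eventually.of_forall fun x _ => hWlim x)
  rw [intervalIntegral.integral_zero] at hint
  obtain ⟨n, hn⟩ := (hint.eventually_lt_const hκ).exists
  exact ⟨_, g n, hgmem n, hn⟩

/-- Mass conservation and monotonicity bound the distance to the step function by the mean distance
to the set of wells: the two phases miss the same mass, and one of them, `[0, θ]` or `[θ, 1]`, lies
entirely in its own half of `[a, b]`. -/
theorem integral_abs_sub_step_le {R : ℝ → ℝ} {a b c : ℝ} (hc : c ∈ Ioo a b) (hRc : Continuous R)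
    (hmono : MonotoneOn R (Icc 0 1)) (hmem : ∀ x ∈ Icc (0 : ℝ) 1, R x ∈ Icc a b)
    (hmean : ∫ x in (0 : ℝ)..1, R x = c) :
    ∫ x in (0 : ℝ)..1, |R x - if x ≤ (b - c) / (b - a) then a else b|
      ≤ 2 * ∫ x in (0 : ℝ)..1, min (R x - a) (b - R x) := by
  have hab : 0 < b - a := by linarith [hc.1, hc.2]
  set θ := (b - c) / (b - a) with hθ
  have hθ0 : 0 < θ := div_pos (by linarith [hc.2]) hab
  have hθ1 : θ < 1 := (div_lt_one hab).2 (by linarith [hc.1])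
  have hθm : θ ∈ Icc (0 : ℝ) 1 := ⟨hθ0.le, hθ1.le⟩
  have hii : ∀ (f : ℝ → ℝ) (_ : Continuous f) (u v : ℝ),
      IntervalIntegrable f MeasureTheory.volume u v := fun f hf u v => hf.intervalIntegrable u v
  have hsplit : ∫ x in (0 : ℝ)..1, |R x - if x ≤ θ then a else b|
      = (∫ x in (0 : ℝ)..θ, (R x - a)) + ∫ x in θ..1, (b - R x) := by
    rw [← (integral_ite_le (f := fun x => R x - a) (g := fun x => b - R x) (by fun_prop)
      (by fun_prop) hθm).2]
    refine intervalIntegral.integral_congr fun x hx => ?_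
    rw [uIcc_of_le zero_le_one] at hx
    have := hmem x hx
    split_ifs
    · exact abs_of_nonneg (sub_nonneg.2 this.1)
    · rw [abs_sub_comm]
      exact abs_of_nonneg (sub_nonneg.2 this.2)
  have hmass : ∫ x in (0 : ℝ)..θ, (R x - a) = ∫ x in θ..1, (b - R x) := by
    have h1 := intervalIntegral.integral_add_adjacent_intervals (hii R hRc 0 θ) (hii R hRc θ 1)
    rw [intervalIntegral.integral_sub (hii _ hRc _ _) (hii _ continuous_const _ _),
      intervalIntegral.integral_sub (hii _ continuous_const _ _) (hii _ hRc _ _)]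
    simp only [intervalIntegral.integral_const, smul_eq_mul]
    have h2 : θ * (b - a) = b - c := by rw [hθ]; field_simp
    linarith
  have hmc : Continuous fun x => min (R x - a) (b - R x) := by fun_prop
  have hmn : ∀ x ∈ Icc (0 : ℝ) 1, 0 ≤ min (R x - a) (b - R x) := fun x hx =>
    le_min (sub_nonneg.2 (hmem x hx).1) (sub_nonneg.2 (hmem x hx).2)
  have hadd := intervalIntegral.integral_add_adjacent_intervals (hii _ hmc 0 θ) (hii _ hmc θ 1)
  have hn1 : 0 ≤ ∫ x in (0 : ℝ)..θ, min (R x - a) (b - R x) :=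
    intervalIntegral.integral_nonneg hθ0.le fun x hx => hmn x ⟨hx.1, hx.2.trans hθ1.le⟩
  have hn2 : 0 ≤ ∫ x in θ..1, min (R x - a) (b - R x) :=
    intervalIntegral.integral_nonneg hθ1.le fun x hx => hmn x ⟨hθ0.le.trans hx.1, hx.2⟩
  rw [hsplit]
  rcases le_total (R θ) ((a + b) / 2) with hle | hle
  · have : ∫ x in (0 : ℝ)..θ, min (R x - a) (b - R x) = ∫ x in (0 : ℝ)..θ, (R x - a) := by
      refine intervalIntegral.integral_congr fun x hx => ?_
      rw [uIcc_of_le hθ0.le] at hx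
      have := hmono ⟨hx.1, hx.2.trans hθ1.le⟩ hθm hx.2
      exact min_eq_left (by linarith)
    linarith
  · have : ∫ x in θ..1, min (R x - a) (b - R x) = ∫ x in θ..1, (b - R x) := by
      refine intervalIntegral.integral_congr fun x hx => ?_
      rw [uIcc_of_le hθ1.le] at hx
      have := hmono hθm ⟨hθ0.le.trans hx.1, hx.2⟩ hx.1
      exact min_eq_right (by linarith)
    linarith

theorem exists_min_sub_le_add_mul {W : ℝ → ℝ} {a b δ : ℝ} (hab : a < b) (hδ : 0 < δ)
    (hW : Continuous W) (hnn : ∀ r, 0 ≤ W r) (hpos : ∀ r, r ≠ a → r ≠ b → 0 < W r) :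
    ∃ C, ∀ r ∈ Icc a b, min (r - a) (b - r) ≤ δ + C * W r := by
  have hK : IsCompact (Icc (a + δ) (b - δ)) := isCompact_Icc
  rcases (Icc (a + δ) (b - δ)).eq_empty_or_nonempty with he | hne
  · refine ⟨0, fun r _ => ?_⟩
    by_contra! hlt
    rw [zero_mul, add_zero, lt_min_iff] at hlt
    have : r ∈ Icc (a + δ) (b - δ) := ⟨by linarith [hlt.1], by linarith [hlt.2]⟩
    rw [he] at this
    exact this
  · obtain ⟨r₀, hr₀, hmin⟩ := hK.exists_isMinOn hne hW.continuousOn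
    have hp : 0 < W r₀ := hpos r₀ (by linarith [hr₀.1]) (by linarith [hr₀.2])
    refine ⟨(b - a) / W r₀, fun r hr => ?_⟩
    have hC : 0 ≤ (b - a) / W r₀ := div_nonneg (sub_nonneg.2 hab.le) hp.le
    by_cases hmem : r ∈ Icc (a + δ) (b - δ)
    · have h1 : b - a ≤ (b - a) / W r₀ * W r := by
        rw [div_mul_eq_mul_div, le_div_iff₀ hp]
        exact mul_le_mul_of_nonneg_left (hmin hmem) (sub_nonneg.2 hab.le)
      have h2 : min (r - a) (b - r) ≤ r - a := min_le_left _ _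
      linarith [hr.2]
    · have h1 : min (r - a) (b - r) ≤ δ := by
        by_contra! hlt
        rw [lt_min_iff] at hlt
        exact hmem ⟨by linarith [hlt.1], by linarith [hlt.2]⟩
      have := mul_nonneg hC (hnn r)
      linarith

/-- For every `η > 0` there is a transition profile, such that the potential energy of the profiles
vanishes in the limit `η → 0`, and the profiles converge to a step function. -/
theorem exists_transitionProfiles {W w : ℝ → ℝ} {a b B c : ℝ} (h : IsDoubleWell W w a b B)
    (hc : c ∈ Ioo a b) :
    ∃ R : ℝ → ℝ → ℝ, (∀ η, 0 < η → IsTransitionProfile w a b c η (R η)) ∧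
      Tendsto (fun η => ∫ x in (0 : ℝ)..1, W (R η x)) (𝓝[>] 0) (𝓝 0) ∧
      Tendsto (fun η => ∫ x in (0 : ℝ)..1, |R η x - if x ≤ (b - c) / (b - a) then a else b|)
        (𝓝[>] 0) (𝓝 0) := by
  choose! R hR hmin using fun η (hη : 0 < η) => exists_isTransitionProfile h hc hη
  have hW := h.continuous
  have hB := h.bound_pos
  have hpot : Tendsto (fun η => ∫ x in (0 : ℝ)..1, W (R η x)) (𝓝[>] 0) (𝓝 0) := by
    refine tendsto_order.2 ⟨fun u hu => Eventually.of_forall fun η => hu.trans_le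
      (intervalIntegral.integral_nonneg zero_le_one fun x _ => h.nonneg _), fun u hu => ?_⟩
    obtain ⟨M, g, hg, hlt⟩ := exists_admissibleSlope_potential_lt hW h.left h.right hc hu
    have hdc := continuous_densityOfSlope c g.continuous
    have hE : ∀ η, slopeEnergy W η c g = η * (∫ x in (0 : ℝ)..1, g x ^ 2 / 2)
        + ∫ x in (0 : ℝ)..1, W (densityOfSlope c g x) := by
      intro η
      rw [← intervalIntegral.integral_const_mul, ← intervalIntegral.integral_add
        (Continuous.intervalIntegrable (by fun_prop) _ _)
        (Continuous.intervalIntegrable (by fun_prop) _ _)]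
      refine intervalIntegral.integral_congr fun x _ => ?_
      ring
    have hElim : Tendsto (fun η => slopeEnergy W η c g) (𝓝[>] 0)
        (𝓝 (∫ x in (0 : ℝ)..1, W (densityOfSlope c g x))) := by
      simp only [hE]
      refine tendsto_nhdsWithin_of_tendsto_nhds ?_
      have : Continuous fun η : ℝ => η * (∫ x in (0 : ℝ)..1, g x ^ 2 / 2)
        + ∫ x in (0 : ℝ)..1, W (densityOfSlope c g x) := by fun_prop
      simpa using this.tendsto 0
    have hM : Tendsto (fun η => 2 * B / η) (𝓝[>] (0 : ℝ)) atTop :=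
      tendsto_inv_nhdsGT_zero.const_mul_atTop (by positivity)
    filter_upwards [hElim.eventually_lt_const hlt, hM.eventually_ge_atTop M, self_mem_nhdsWithin]
      with η h1 h2 h3
    refine (hmin η h3 g ⟨hg.1, hg.2.1, fun x y => (hg.2.2 x y).trans ?_⟩).trans_lt h1
    gcongr
  refine ⟨R, hR, hpot, ?_⟩
  refine tendsto_order.2 ⟨fun u hu => Eventually.of_forall fun η => hu.trans_le
    (intervalIntegral.integral_nonneg zero_le_one fun x _ => abs_nonneg _), fun u hu => ?_⟩
  obtain ⟨C, hC⟩ := exists_min_sub_le_add_mul h.lt (show 0 < u / 4 by positivity) hW h.nonneg h.pos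
  have hlim : Tendsto (fun η => 2 * (u / 4 + C * ∫ x in (0 : ℝ)..1, W (R η x))) (𝓝[>] 0)
      (𝓝 (2 * (u / 4 + C * 0))) := ((hpot.const_mul C).const_add _).const_mul 2
  filter_upwards [hlim.eventually_lt_const (show 2 * (u / 4 + C * 0) < u by linarith),
    self_mem_nhdsWithin] with η h1 h2
  have hp := hR η h2
  have hpc := hp.continuous
  refine (integral_abs_sub_step_le hc hpc hp.monotoneOn hp.mem hp.mean).trans_lt
    (lt_of_le_of_lt ?_ h1)
  refine mul_le_mul_of_nonneg_left ?_ zero_le_two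
  calc ∫ x in (0 : ℝ)..1, min (R η x - a) (b - R η x)
      ≤ ∫ x in (0 : ℝ)..1, (u / 4 + C * W (R η x)) :=
        intervalIntegral.integral_mono_on zero_le_one
          (Continuous.intervalIntegrable (by fun_prop) _ _)
          (Continuous.intervalIntegrable (by fun_prop) _ _) fun x hx => hC _ (hp.mem x hx)
    _ = u / 4 + C * ∫ x in (0 : ℝ)..1, W (R η x) := by
        rw [intervalIntegral.integral_add (continuous_const.intervalIntegrable _ _)
          (Continuous.intervalIntegrable (by fun_prop) _ _), intervalIntegral.integral_const_mul]
        simp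

/-! ### Even periodic extension -/

/-- The even `2`-periodic triangle wave with values in `[0, 1]` that is the identity on `[0, 1]`:
the distance to the nearest even integer. -/
noncomputable def triangleWave (x : ℝ) : ℝ := ‖(x : AddCircle (2 : ℝ))‖

theorem continuous_triangleWave : Continuous triangleWave :=
  continuous_norm.comp (AddCircle.continuous_mk' 2)

theorem triangleWave_mem (x : ℝ) : triangleWave x ∈ Icc (0 : ℝ) 1 := by
  refine ⟨norm_nonneg _, (AddCircle.norm_le_half_period 2 two_ne_zero).trans ?_⟩
  norm_num

theorem triangleWave_of_mem {x : ℝ} (hx : x ∈ Icc (0 : ℝ) 1) : triangleWave x = x := by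
  rw [triangleWave, (AddCircle.norm_coe_eq_abs_iff 2 two_ne_zero).2, abs_of_nonneg hx.1]
  rw [abs_of_nonneg hx.1, abs_two]
  linarith [hx.2]

theorem triangleWave_neg (x : ℝ) : triangleWave (-x) = triangleWave x := by
  rw [triangleWave, AddCircle.coe_neg, norm_neg, triangleWave]

theorem triangleWave_add_two (x : ℝ) : triangleWave (x + 2) = triangleWave x := by
  rw [triangleWave, AddCircle.coe_add_period, triangleWave]

theorem triangleWave_two_sub (x : ℝ) : triangleWave (2 - x) = triangleWave x := by
  rw [sub_eq_neg_add, triangleWave_add_two, triangleWave_neg]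

/-- An even `2`-periodic function is determined by its values on `[0, 1]`. -/
theorem comp_triangleWave_eq {f : ℝ → ℝ} (heven : ∀ x, f (-x) = f x)
    (hper : Function.Periodic f 2) (x : ℝ) : f (triangleWave x) = f x := by
  rw [triangleWave, AddCircle.norm_eq]
  set k := round ((2 : ℝ)⁻¹ * x)
  have hk : f (x - k * 2) = f x := hper.sub_int_mul_eq k
  rcases abs_choice (x - k * 2) with h | h
  · rw [h, hk]
  · rw [h, heven, hk]

theorem integral_zero_neg_of_even {f : ℝ → ℝ} (hf : ∀ x, f (-x) = f x) (x : ℝ) :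
    ∫ y in (0 : ℝ)..-x, f y = -∫ y in (0 : ℝ)..x, f y := by
  have := intervalIntegral.integral_comp_neg (a := x) (b := 0) f
  simp only [hf, neg_zero] at this
  rw [← this, intervalIntegral.integral_symm]

theorem integral_zero_neg_of_odd {f : ℝ → ℝ} (hf : ∀ x, f (-x) = -f x) (x : ℝ) :
    ∫ y in (0 : ℝ)..-x, f y = ∫ y in (0 : ℝ)..x, f y := by
  have := intervalIntegral.integral_comp_neg (a := x) (b := 0) f
  simp only [hf, neg_zero, intervalIntegral.integral_neg] at this
  rw [← this, intervalIntegral.integral_symm, neg_neg]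

theorem integral_comp_triangleWave {f : ℝ → ℝ}
    (hf : IntervalIntegrable f MeasureTheory.volume 0 1) :
    ∫ x in (0 : ℝ)..2, f (triangleWave x) = 2 * ∫ x in (0 : ℝ)..1, f x := by
  have e : EqOn (fun x => f (triangleWave x)) f (uIcc 0 1) := fun x hx => by
    rw [uIcc_of_le zero_le_one] at hx
    simp only [triangleWave_of_mem hx]
  have i1 := (intervalIntegrable_congr (μ := MeasureTheory.volume)
    (e.mono uIoc_subset_uIcc)).2 hf
  have i2 := (i1.comp_sub_left 2).symm
  norm_num [triangleWave_two_sub] at i2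
  have h2 := intervalIntegral.integral_comp_sub_left (a := (0 : ℝ)) (b := 1)
    (fun x => f (triangleWave x)) 2
  norm_num [triangleWave_two_sub] at h2
  rw [← intervalIntegral.integral_add_adjacent_intervals i1 i2, ← h2,
    intervalIntegral.integral_congr e]
  ring

/-- The even `2`-periodic extension of a transition profile solves the profile equation on `ℝ`.
The double primitive of `(w(R) - λ) / η`, with `R` extended, is even and `2`-periodic because
`w(R) - λ` is even, `2`-periodic and has mean value zero; and it equals `R` on `[0, 1]`. -/
theorem IsTransitionProfile.hasDerivAt_comp_triangleWave {w R : ℝ → ℝ} {a b c η : ℝ}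
    (h : IsTransitionProfile w a b c η R) (hw : Continuous w) (x : ℝ) :
    HasDerivAt (R ∘ triangleWave) (flux w (R ∘ triangleWave) x / η) x := by
  set S := R ∘ triangleWave with hS
  have hSc : Continuous S := h.continuous.comp continuous_triangleWave
  have hSeven : ∀ x, S (-x) = S x := fun x => by simp only [hS, Function.comp, triangleWave_neg]
  have hSper : ∀ x, S (x + 2) = S x := fun x => by
    simp only [hS, Function.comp, triangleWave_add_two]
  have hSR : ∀ x ∈ Icc (0 : ℝ) 1, S x = R x := fun x hx => by
    simp only [hS, Function.comp, triangleWave_of_mem hx]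
  have hfc := continuous_flux hw hSc
  have hodd : ∀ x, flux w S (-x) = -flux w S x :=
    integral_zero_neg_of_even fun x => by rw [hSeven]
  have hqper : Function.Periodic (fun y => w (S y) - multiplier w S) 2 := fun x => by
    simp only [hSper]
  have hfper : Function.Periodic (flux w S) 2 := by
    intro x
    have hii : ∀ u v, IntervalIntegrable (fun y => w (S y) - multiplier w S)
        MeasureTheory.volume u v := fun u v => Continuous.intervalIntegrable (by fun_prop) _ _
    have h1 := hqper.intervalIntegral_add_eq x (-1)
    have h2 := intervalIntegral.integral_add_adjacent_intervals (hii 0 x) (hii x (x + 2))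
    have h3 := intervalIntegral.integral_add_adjacent_intervals (hii (-1) 0) (hii 0 1)
    have h4 : ∫ y in (-1 : ℝ)..0, (w (S y) - multiplier w S) = flux w S 1 := by
      rw [intervalIntegral.integral_symm, show ∫ y in (0 : ℝ)..-1, (w (S y) - multiplier w S)
        = flux w S (-1) from rfl, hodd, neg_neg]
    have h5 : ∫ y in (0 : ℝ)..1, (w (S y) - multiplier w S) = flux w S 1 := rfl
    rw [h4, h5, flux_one hw hSc] at h3
    rw [show (-1 : ℝ) + 2 = 1 by norm_num] at h1
    rw [h1, ← h3] at h2
    simp only [flux]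
    linarith
  set T : ℝ → ℝ := fun x => R 0 + ∫ y in (0 : ℝ)..x, flux w S y / η with hT
  have hTd : ∀ x, HasDerivAt T (flux w S x / η) x := fun x =>
    ((Continuous.integral_hasStrictDerivAt (f := fun y => flux w S y / η)
      (by fun_prop) 0 x).hasDerivAt).const_add _
  have hTeven : ∀ x, T (-x) = T x := fun x => by
    simp only [hT]
    rw [integral_zero_neg_of_odd fun x => by rw [hodd, neg_div]]
  have hTper : Function.Periodic T 2 := by
    intro x
    have hii : ∀ u v, IntervalIntegrable (fun y => flux w S y / η)
        MeasureTheory.volume u v := fun u v => Continuous.intervalIntegrable (by fun_prop) _ _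
    have hper : Function.Periodic (fun y => flux w S y / η) 2 := fun x => by
      simp only [hfper x]
    have h1 := hper.intervalIntegral_add_eq x (-1)
    have h2 := intervalIntegral.integral_add_adjacent_intervals (hii 0 x) (hii x (x + 2))
    have h3 := intervalIntegral.integral_add_adjacent_intervals (hii (-1) 0) (hii 0 1)
    have h4 : ∫ y in (-1 : ℝ)..0, flux w S y / η = -∫ y in (0 : ℝ)..1, flux w S y / η := by
      rw [intervalIntegral.integral_symm,
        integral_zero_neg_of_odd fun x => by rw [hodd, neg_div]]
    rw [show (-1 : ℝ) + 2 = 1 by norm_num] at h1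
    rw [h1, ← h3, h4] at h2
    simp only [hT]
    linarith
  have hfeq : ∀ x ∈ Icc (0 : ℝ) 1, flux w S x = flux w R x := by
    intro x hx
    have hm : multiplier w S = multiplier w R := by
      refine intervalIntegral.integral_congr fun y hy => ?_
      rw [uIcc_of_le zero_le_one] at hy
      simp only [hSR y hy]
    refine intervalIntegral.integral_congr fun y hy => ?_
    rw [uIcc_of_le hx.1] at hy
    simp only [hSR y ⟨hy.1, hy.2.trans hx.2⟩, hm]
  have hTR : ∀ x ∈ Icc (0 : ℝ) 1, T x = R x := by
    intro x hx
    have := intervalIntegral.integral_eq_sub_of_hasDerivAt (a := 0) (b := x) (f := R)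
      (f' := fun y => flux w R y / η)
      (fun y hy => by
        rw [uIcc_of_le hx.1] at hy
        exact h.hasDerivAt y ⟨hy.1, hy.2.trans hx.2⟩)
      (Continuous.intervalIntegrable ((continuous_flux hw h.continuous).div_const _) _ _)
    have h2 : ∫ y in (0 : ℝ)..x, flux w S y / η = ∫ y in (0 : ℝ)..x, flux w R y / η := by
      refine intervalIntegral.integral_congr fun y hy => ?_
      rw [uIcc_of_le hx.1] at hy
      simp only [hfeq y ⟨hy.1, hy.2.trans hx.2⟩]
    simp only [hT, h2, this]
    ring
  have hTS : T = S := funext fun x => by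
    rw [← comp_triangleWave_eq hTeven hTper x, hTR _ (triangleWave_mem x)]
    rfl
  exact hTS ▸ hTd x

/-- The step function with one phase on either side of `θ`, extended evenly and scaled to period
`ω`, has exactly two jumps per period. -/
theorem hasExactlyTwoJumps_step {a b θ ω : ℝ} (hθ0 : 0 < θ) (hθ1 : θ < 1) (hω : 0 < ω) :
    HasExactlyTwoJumps ω a b fun x => if triangleWave (x / (ω / 2)) ≤ θ then a else b := by
  have hω2 : 0 < ω / 2 := by positivity
  have hadd : ∀ x, triangleWave ((x + ω) / (ω / 2)) = triangleWave (x / (ω / 2)) := fun x => by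
    rw [← triangleWave_add_two (x / (ω / 2))]
    congr 1
    field_simp
  refine ⟨fun x => by simp only [hadd], fun x => ?_, θ * (ω / 2), (2 - θ) * (ω / 2), ?_, ?_,
    fun x hx => ?_, fun x hx => ?_⟩
  · dsimp only
    split_ifs
    · exact Or.inl rfl
    · exact Or.inr rfl
  · gcongr
    linarith
  · nlinarith
  · have h1 : θ < x / (ω / 2) := (lt_div_iff₀ hω2).2 hx.1
    have h2 : x / (ω / 2) < 2 - θ := (div_lt_iff₀ hω2).2 hx.2
    refine if_neg (not_le.2 ?_)
    rcases le_total (x / (ω / 2)) 1 with h | h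
    · rwa [triangleWave_of_mem ⟨hθ0.le.trans h1.le, h⟩]
    · rw [← triangleWave_two_sub, triangleWave_of_mem ⟨by linarith, by linarith⟩]
      linarith
  · have h1 : 2 - θ < x / (ω / 2) := (lt_div_iff₀ hω2).2 hx.1
    have h2 : x / (ω / 2) < 2 + θ := (div_lt_iff₀ hω2).2 (by linarith [hx.2])
    refine if_pos ?_
    rcases le_total (x / (ω / 2)) 2 with h | h
    · rw [← triangleWave_two_sub, triangleWave_of_mem ⟨by linarith, by linarith⟩]
      linarith
    · rw [← sub_add_cancel (x / (ω / 2)) 2, triangleWave_add_two,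
        triangleWave_of_mem ⟨by linarith, by linarith⟩]
      linarith

/-! ### The double well of the modified energy -/

/-- The excess of a bitangent energy over its double tangent, continued outside `[a, b]` so that it
is positive there, is a double well potential. -/
theorem IsBitangentDoubleWell.exists_isDoubleWell {Φ : ℝ → ℝ} {a b : ℝ}
    (h : IsBitangentDoubleWell Φ a b) (hΦ : ContDiffOn ℝ 2 Φ (Ioi 0)) :
    ∃ W w : ℝ → ℝ, ∃ B, IsDoubleWell W w a b B ∧ ∀ r ∈ Icc a b, w r = deriv Φ r - deriv Φ a := by
  have hab := h.lt
  have hsub : Icc a b ⊆ Ioi 0 := fun r hr => h.pos.trans_le hr.1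
  have hdc : ContinuousOn (deriv Φ) (Icc a b) :=
    (hΦ.continuousOn_deriv_of_isOpen isOpen_Ioi (by norm_num)).mono hsub
  have hΦd : ∀ r ∈ Icc a b, HasDerivAt Φ (deriv Φ r) r := fun r hr =>
    ((hΦ.differentiableOn two_ne_zero).differentiableAt (Ioi_mem_nhds (hsub hr))).hasDerivAt
  set π : ℝ → ℝ := fun r => max a (min b r) with hπ
  have hπc : Continuous π := by fun_prop
  have hπm : ∀ r, π r ∈ Icc a b := fun r => ⟨le_max_left _ _, max_le hab.le (min_le_left _ _)⟩
  have hπid : ∀ r ∈ Icc a b, π r = r := fun r hr => by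
    simp only [hπ, min_eq_right hr.2, max_eq_right hr.1]
  have hπb : ∀ r, b ≤ r → π r = b := fun r hr => by
    simp only [hπ, min_eq_left hr, max_eq_right hab.le]
  have hπa : ∀ r, r ≤ a → π r = a := fun r hr => by
    simp only [hπ, min_eq_right (hr.trans hab.le), max_eq_left hr]
  set w : ℝ → ℝ := fun r => deriv Φ (π r) - deriv Φ a + max (-1) (min 1 (r - π r)) with hw
  have hwc : Continuous w := by
    have : Continuous fun r => deriv Φ (π r) :=
      hdc.comp_continuous hπc hπm
    fun_prop
  have hwin : ∀ r ∈ Icc a b, w r = deriv Φ r - deriv Φ a := fun r hr => by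
    simp [hw, hπid r hr]
  have hwb : ∀ r, b < r → 0 < w r := fun r hr => by
    simp only [hw, hπb r hr.le, h.tangent_slope, sub_self, zero_add]
    exact lt_max_of_lt_right (lt_min one_pos (sub_pos.2 hr))
  have hwa : ∀ r, r < a → w r < 0 := fun r hr => by
    simp only [hw, hπa r hr.le, sub_self, zero_add]
    exact max_lt (by norm_num) (min_lt_of_right_lt (sub_neg.2 hr))
  obtain ⟨K, hK⟩ := isCompact_Icc.exists_bound_of_continuousOn
    (hdc.sub (continuousOn_const (c := deriv Φ a)))
  have hKn : 0 ≤ K := (norm_nonneg _).trans (hK a (left_mem_Icc.2 hab.le))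
  set W : ℝ → ℝ := fun r => ∫ y in a..r, w y with hW
  have hWin : ∀ r ∈ Icc a b, W r = Φ r - tangentLine Φ a r := by
    intro r hr
    have hd : ∀ y ∈ uIcc a r, HasDerivAt (fun y => Φ y - tangentLine Φ a y) (w y) y := by
      intro y hy
      rw [uIcc_of_le hr.1] at hy
      have hy' : y ∈ Icc a b := ⟨hy.1, hy.2.trans hr.2⟩
      have h1 : HasDerivAt (tangentLine Φ a) (deriv Φ a) y := by
        have := (((hasDerivAt_id y).sub_const a).const_mul (deriv Φ a)).add_const (Φ a)
        rwa [mul_one] at this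
      exact ((hΦd y hy').sub h1).congr_deriv (hwin y hy').symm
    rw [hW]
    simp only
    rw [intervalIntegral.integral_eq_sub_of_hasDerivAt hd (hwc.intervalIntegrable _ _)]
    simp [tangentLine]
  have hWb : W b = 0 := by
    rw [hWin b (right_mem_Icc.2 hab.le), h.tangent_value, sub_self]
  obtain ⟨δ, hδ, habove⟩ := h.above
  refine ⟨W, w, K + 1, ⟨hab, fun r => (hwc.integral_hasStrictDerivAt a r).hasDerivAt, hwc,
    by positivity, fun r => ?_, intervalIntegral.integral_same, hWb, fun r ha hb => ?_⟩, hwin⟩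
  · refine (abs_add_le _ _).trans (add_le_add (hK (π r) (hπm r)) (abs_le.2 ⟨le_max_left _ _, ?_⟩))
    exact max_le (by norm_num) (min_le_left _ _)
  · rcases lt_or_gt_of_ne ha with hlt | hgt
    · have := intervalIntegral.intervalIntegral_pos_of_pos_on (f := fun y => -w y)
        (hwc.neg.intervalIntegrable r a) (fun y hy => neg_pos.2 (hwa y hy.2)) hlt
      rwa [intervalIntegral.integral_neg, ← intervalIntegral.integral_symm] at this
    rcases lt_or_gt_of_ne hb with hlt' | hgt'
    · rw [hWin r ⟨hgt.le, hlt'.le⟩]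
      exact sub_pos.2 (habove r ⟨by linarith, by linarith⟩ ha hb)
    · have h1 := intervalIntegral.intervalIntegral_pos_of_pos_on
        (hwc.intervalIntegrable b r) (fun y hy => hwb y hy.1) hgt'
      have h2 := intervalIntegral.integral_add_adjacent_intervals (μ := MeasureTheory.volume)
        (hwc.intervalIntegrable a b) (hwc.intervalIntegrable b r)
      change W b + _ = W r at h2
      linarith

section ModifiedEnergy

variable {Ψ : ℝ → ℝ} {m : ℝ}

theorem hasDerivAt_modifiedEnergy (hΨ : ContDiffOn ℝ 2 Ψ (Ioi 0)) {r : ℝ} (hr : 0 < r) :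
    HasDerivAt (modifiedEnergy Ψ m) (deriv Ψ r + m ^ 2 / (2 * r ^ 2)) r := by
  have h1 : HasDerivAt Ψ (deriv Ψ r) r :=
    ((hΨ.differentiableOn two_ne_zero).differentiableAt (Ioi_mem_nhds hr)).hasDerivAt
  have h2 : HasDerivAt (fun r : ℝ => m ^ 2 / (2 * r)) (-(m ^ 2 / (2 * r ^ 2))) r := by
    have := ((hasDerivAt_id r).const_mul 2).fun_inv (by simpa using hr.ne') |>.const_mul (m ^ 2)
    refine (this.congr_deriv ?_).congr_of_eventuallyEq (Eventually.of_forall fun y => ?_)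
    · simp only [id]
      field_simp
    · simp only [id, div_eq_mul_inv]
  exact (h1.sub h2).congr_deriv (by ring)

theorem contDiffOn_modifiedEnergy (hΨ : ContDiffOn ℝ 2 Ψ (Ioi 0)) :
    ContDiffOn ℝ 2 (modifiedEnergy Ψ m) (Ioi 0) :=
  hΨ.sub (contDiffOn_const.div (contDiffOn_const.mul contDiffOn_id) fun r hr => by
    have hr : 0 < r := hr
    positivity)

theorem contDiffOn_deriv_of_contDiffOn_two {f : ℝ → ℝ} {s : Set ℝ} (hs : IsOpen s)
    (hf : ContDiffOn ℝ 2 f s) : ContDiffOn ℝ 1 (deriv f) s := by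
  have : ContDiffOn ℝ (1 + 1) f s := by norm_num; exact hf
  exact ((contDiffOn_succ_iff_deriv_of_isOpen hs).1 this).2.2

/-- With constant momentum and no viscosity, the momentum equation is `ρ` times the derivative of
`ε ρ'' = (Ψ^m)'(ρ) - k`. -/
theorem isStationarySolution_of_profile_equation (hΨ : ContDiffOn ℝ 2 Ψ (Ioi 0)) {ε k : ℝ}
    {ρ : ℝ → ℝ} (hpos : ∀ x, 0 < ρ x) (hρ : ContDiff ℝ 2 ρ)
    (heq : ∀ x, ε * deriv (deriv ρ) x = deriv (modifiedEnergy Ψ m) (ρ x) - k) :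
    IsStationarySolution Ψ (fun _ => 0) (fun _ => ε) ρ (fun _ => m) := by
  have hmaps : MapsTo ρ univ (Ioi 0) := fun x _ => hpos x
  have hρ1 : ContDiff ℝ 1 ρ := hρ.of_le (by norm_num)
  have hdΨ := contDiffOn_deriv_of_contDiffOn_two isOpen_Ioi hΨ
  have hdΦ := contDiffOn_deriv_of_contDiffOn_two isOpen_Ioi (contDiffOn_modifiedEnergy (m := m) hΨ)
  have hcomp : ∀ {f : ℝ → ℝ}, ContDiffOn ℝ 1 f (Ioi 0) → ContDiff ℝ 1 fun x => f (ρ x) :=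
    fun hf => contDiffOn_univ.1 (hf.comp hρ1.contDiffOn hmaps)
  have hp : ContDiffOn ℝ 1 (pressure Ψ) (Ioi 0) :=
    (contDiffOn_id.mul hdΨ).sub (hΨ.of_le (by norm_num))
  refine ⟨hpos, hρ, contDiff_const, hcomp hp, by simpa using contDiff_const, ?_, fun x => by simp,
    fun x => ?_⟩
  · simp only [heq]
    exact (hcomp hdΦ).sub contDiff_const
  · have hr := hpos x
    have hΨ1 : HasDerivAt Ψ (deriv Ψ (ρ x)) (ρ x) :=
      ((hΨ.differentiableOn two_ne_zero).differentiableAt (Ioi_mem_nhds hr)).hasDerivAt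
    have hΨ2 : HasDerivAt (deriv Ψ) (deriv (deriv Ψ) (ρ x)) (ρ x) :=
      ((hdΨ.differentiableOn one_ne_zero).differentiableAt (Ioi_mem_nhds hr)).hasDerivAt
    have hρd : HasDerivAt ρ (deriv ρ x) x :=
      ((hρ.differentiable two_ne_zero) x).hasDerivAt
    have d1 : HasDerivAt (fun y => m ^ 2 / ρ y) (m ^ 2 * (-deriv ρ x / ρ x ^ 2)) x := by
      simpa only [div_eq_mul_inv] using (hρd.fun_inv hr.ne').const_mul (m ^ 2)
    have d2 : HasDerivAt (fun y => pressure Ψ (ρ y))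
        (ρ x * deriv (deriv Ψ) (ρ x) * deriv ρ x) x := by
      refine ((((hasDerivAt_id (ρ x)).mul hΨ2).sub hΨ1).comp x hρd).congr_deriv ?_
      simp only [id]
      ring
    have d3 : HasDerivAt (fun y => ε * deriv (deriv ρ) y)
        ((deriv (deriv Ψ) (ρ x) - m ^ 2 / ρ x ^ 3) * deriv ρ x) x := by
      have hsq : HasDerivAt (fun r : ℝ => m ^ 2 / (2 * r ^ 2)) (-(m ^ 2 / ρ x ^ 3)) (ρ x) := by
        have := (((hasDerivAt_id (ρ x)).fun_pow 2).const_mul 2).fun_inv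
          (by simpa using hr.ne') |>.const_mul (m ^ 2)
        refine (this.congr_deriv ?_).congr_of_eventuallyEq (Eventually.of_forall fun y => ?_)
        · simp only [id, Nat.cast_ofNat]
          field_simp
          ring
        · simp only [id, div_eq_mul_inv]
      have := ((hΨ2.add hsq).comp x hρd).sub_const k
      refine (this.congr_deriv (by ring)).congr_of_eventuallyEq (Eventually.of_forall fun y => ?_)
      simp only [heq, (hasDerivAt_modifiedEnergy hΨ (hpos y)).deriv]
      rfl
    simp only [zero_mul, deriv_const, sub_zero]
    rw [d1.deriv, d2.deriv, d3.deriv]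
    field_simp
    ring

/-- With zero momentum the velocity vanishes, and so does the viscous term. -/
theorem IsStationarySolution.of_zero_momentum {κ ρ : ℝ → ℝ}
    (h : IsStationarySolution Ψ (fun _ => 0) κ ρ fun _ => 0) (μ : ℝ → ℝ) :
    IsStationarySolution Ψ μ κ ρ fun _ => 0 := by
  have hv : velocity ρ (fun _ => 0) = fun _ => 0 := funext fun x => by simp [velocity]
  refine ⟨h.density_pos, h.density_C2, h.momentum_C1, h.pressure_C1, ?_, h.capillary_C1, h.mass_eq,
    fun x => ?_⟩
  · simp only [hv, deriv_const, mul_zero]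
    exact contDiff_const
  · have := h.momentum_eq x
    simpa [hv] using this

end ModifiedEnergy

/-! ### Stationary solutions of small capillarity -/

/-- The profile equation for the even periodic extension of a transition profile, rescaled to
period `2 L`. -/
theorem IsTransitionProfile.scaled {w R : ℝ → ℝ} {a b c η : ℝ}
    (h : IsTransitionProfile w a b c η R) (hw : Continuous w) (hη : η ≠ 0) {L : ℝ} (hL : L ≠ 0) :
    ContDiff ℝ 2 (fun x => R (triangleWave (x / L))) ∧ ∃ k, ∀ x,
      η * L ^ 2 * deriv (deriv fun x => R (triangleWave (x / L))) x
        = w (R (triangleWave (x / L))) - k := by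
  set S := R ∘ triangleWave with hS
  have hSc : Continuous S := h.continuous.comp continuous_triangleWave
  have hdiv : ∀ x : ℝ, HasDerivAt (fun x => x / L) (1 / L) x := fun x =>
    (hasDerivAt_id x).div_const L
  have h1 : ∀ x, HasDerivAt (fun x => S (x / L)) (flux w S (x / L) / η * (1 / L)) x := fun x =>
    HasDerivAt.comp (h₂ := S) x (h.hasDerivAt_comp_triangleWave hw (x / L)) (hdiv x)
  have h2 : ∀ x, HasDerivAt (fun x => flux w S (x / L) / η * (1 / L))
      ((w (S (x / L)) - multiplier w S) * (1 / L) / η * (1 / L)) x := fun x =>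
    (((hasDerivAt_flux hw hSc (x / L)).comp x (hdiv x)).div_const η).mul_const (1 / L)
  have hd1 : deriv (fun x => S (x / L)) = fun x => flux w S (x / L) / η * (1 / L) :=
    funext fun x => (h1 x).deriv
  have hd2 : deriv (fun x => flux w S (x / L) / η * (1 / L))
      = fun x => (w (S (x / L)) - multiplier w S) * (1 / L) / η * (1 / L) :=
    funext fun x => (h2 x).deriv
  change ContDiff ℝ 2 (fun x => S (x / L)) ∧ ∃ k, ∀ x,
    η * L ^ 2 * deriv (deriv fun x => S (x / L)) x = w (S (x / L)) - k
  refine ⟨?_, multiplier w S, fun x => ?_⟩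
  · rw [← one_add_one_eq_two, contDiff_succ_iff_deriv, hd1, contDiff_one_iff_deriv, hd2]
    exact ⟨fun x => (h1 x).differentiableAt, by simp, fun x => (h2 x).differentiableAt,
      by fun_prop⟩
  · rw [hd1, hd2]
    field_simp

theorem theorem3p1 (Ψ : ℝ → ℝ) (hΨ : ContDiffOn ℝ 2 Ψ (Ioi 0))
    (m ρg ρl : ℝ) (hm : IsBitangentDoubleWell (modifiedEnergy Ψ m) ρg ρl)
    (ρs : ℝ) (hρs : ρs ∈ Ioo ρg ρl) :
    ∃ ε₀ : ℝ, 0 < ε₀ ∧ ∃ ρ : ℝ → ℝ → ℝ → ℝ,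
      -- `ρ ε ω` is the solution with relaxation parameter `ε` and period `ω`
      (∀ ε ω : ℝ, 0 < ε → 0 < ω → ε / ω ^ 2 < ε₀ →
        IsStationarySolution Ψ (fun _ => 0) (fun _ => ε) (ρ ε ω) (fun _ => m) ∧
        Function.Periodic (ρ ε ω) ω ∧
        ¬ IsConstantFunction (ρ ε ω) ∧
        (1 / ω) * (∫ x in (0 : ℝ)..ω, ρ ε ω x) = ρs ∧
        (∀ x, ρ ε ω x ∈ Icc ρg ρl) ∧
        (m ≠ 0 → ¬ IsConstantFunction (velocity (ρ ε ω) (fun _ => m))) ∧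
        (m = 0 → ∀ μ : ℝ → ℝ, (∀ r, 0 < r → 0 < μ r) →
          IsStationarySolution Ψ μ (fun _ => ε) (ρ ε ω) (fun _ => m) ∧
          IsConstantFunction (velocity (ρ ε ω) (fun _ => m)))) ∧
      -- convergence in `L¹` over a period as `ε ↓ 0`
      (∀ ω : ℝ, 0 < ω → ∃ ρ₀ : ℝ → ℝ, HasExactlyTwoJumps ω ρg ρl ρ₀ ∧
        Tendsto (fun ε => ∫ x in (0 : ℝ)..ω, |ρ ε ω x - ρ₀ x|) (𝓝[>] 0) (𝓝 0)) := by
  obtain ⟨W, w, B, hW, hw⟩ := hm.exists_isDoubleWell (contDiffOn_modifiedEnergy hΨ)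
  obtain ⟨R, hR, hpot, hlim⟩ := exists_transitionProfiles hW hρs
  have hlg : 0 < ρl - ρg := sub_pos.2 hm.lt
  have hscale : ∀ (f : ℝ → ℝ) (ω : ℝ), 0 < ω → IntervalIntegrable f MeasureTheory.volume 0 1 →
      ∫ x in (0 : ℝ)..ω, f (triangleWave (x / (ω / 2))) = ω * ∫ x in (0 : ℝ)..1, f x := by
    intro f ω hω hf
    rw [intervalIntegral.integral_comp_div (fun x => f (triangleWave x)) (by positivity), zero_div,
      show ω / (ω / 2) = 2 by field_simp, integral_comp_triangleWave hf, smul_eq_mul]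
    ring
  have hcpos : 0 < W ρs := hW.pos ρs hρs.1.ne' hρs.2.ne
  obtain ⟨η₀, hη₀, hsmall⟩ := mem_nhdsGT_iff_exists_Ioo_subset.1 (hpot.eventually_lt_const hcpos)
  have hη₀ : 0 < η₀ := hη₀
  refine ⟨η₀ / 4, by positivity, fun ε ω x => R (4 * (ε / ω ^ 2)) (triangleWave (x / (ω / 2))),
    fun ε ω hε hω hlt => ?_, fun ω hω => ?_⟩
  · set η := 4 * (ε / ω ^ 2) with hηdef
    have hη : 0 < η := by positivity
    have hlow : ∫ x in (0 : ℝ)..1, W (R η x) < W ρs := hsmall ⟨hη, by linarith⟩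
    have hp := hR η hη
    obtain ⟨hC2, k, hk⟩ := hp.scaled hW.continuous_deriv hη.ne' (L := ω / 2)
      (by positivity)
    have hηω : η * (ω / 2) ^ 2 = ε := by
      rw [hηdef]
      field_simp
      ring
    have hmem : ∀ x, R η (triangleWave (x / (ω / 2))) ∈ Icc ρg ρl := fun x =>
      hp.mem _ (triangleWave_mem _)
    have hpos : ∀ x, 0 < R η (triangleWave (x / (ω / 2))) := fun x => hm.pos.trans_le (hmem x).1
    have hsol : IsStationarySolution Ψ (fun _ => 0) (fun _ => ε)
        (fun x => R η (triangleWave (x / (ω / 2)))) (fun _ => m) := by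
      refine isStationarySolution_of_profile_equation hΨ
        (k := deriv (modifiedEnergy Ψ m) ρg + k) hpos hC2 fun x => ?_
      rw [← hηω, hk x, hw _ (hmem x)]
      ring
    -- A constant profile would be `ρs`, with potential energy `W ρs`.
    have hnc : ¬ IsConstantFunction fun x => R η (triangleWave (x / (ω / 2))) := by
      rintro ⟨d, hd⟩
      have hconst : ∀ y ∈ Icc (0 : ℝ) 1, R η y = d := fun y hy => by
        have : R η (triangleWave (y * (ω / 2) / (ω / 2))) = d := hd (y * (ω / 2))
        rwa [mul_div_assoc, div_self (by positivity), mul_one, triangleWave_of_mem hy] at this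
      have h1 : ∫ x in (0 : ℝ)..1, R η x = ∫ x in (0 : ℝ)..1, d :=
        intervalIntegral.integral_congr fun y hy => hconst y (by rwa [uIcc_of_le zero_le_one] at hy)
      have h2 : ∫ x in (0 : ℝ)..1, W (R η x) = ∫ x in (0 : ℝ)..1, W d :=
        intervalIntegral.integral_congr fun y hy => by
          rw [uIcc_of_le zero_le_one] at hy
          simp only [hconst y hy]
      rw [hp.mean] at h1
      simp only [intervalIntegral.integral_const, sub_zero, one_smul] at h1 h2
      rw [h2, h1] at hlow
      exact hlow.false
    refine ⟨hsol, fun x => ?_, hnc, ?_, hmem, fun hm0 => ?_, fun hm0 μ _ => ?_⟩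
    · dsimp only
      rw [← triangleWave_add_two (x / (ω / 2))]
      congr 2
      field_simp
    · rw [hscale (R η) ω hω (hp.continuous.intervalIntegrable _ _), hp.mean]
      field_simp
    · rintro ⟨d, hd⟩
      refine hnc ⟨m / d, fun x => ?_⟩
      have := hd x
      simp only [velocity] at this
      rw [← this, div_div_cancel₀ hm0]
    · subst hm0
      exact ⟨hsol.of_zero_momentum μ, 0, fun x => by simp [velocity]⟩
  · have hθ0 : 0 < (ρl - ρs) / (ρl - ρg) := div_pos (sub_pos.2 hρs.2) hlg
    have hθ1 : (ρl - ρs) / (ρl - ρg) < 1 := (div_lt_one hlg).2 (by linarith [hρs.1])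
    refine ⟨_, hasExactlyTwoJumps_step hθ0 hθ1 hω, ?_⟩
    have hη : Tendsto (fun ε => 4 * (ε / ω ^ 2)) (𝓝[>] 0) (𝓝[>] 0) := by
      refine tendsto_nhdsWithin_iff.2 ⟨tendsto_nhdsWithin_of_tendsto_nhds ?_, ?_⟩
      · have : Continuous fun ε : ℝ => 4 * (ε / ω ^ 2) := by fun_prop
        simpa using this.tendsto 0
      · filter_upwards [self_mem_nhdsWithin] with ε hε
        have hε : 0 < ε := hε
        exact mem_Ioi.2 (by positivity)
    have hmul := (hlim.comp hη).const_mul ω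
    rw [mul_zero] at hmul
    refine hmul.congr' ?_
    filter_upwards [hη self_mem_nhdsWithin] with ε hε
    have hp := hR _ hε
    refine (hscale (fun y => |R (4 * (ε / ω ^ 2)) y
      - if y ≤ (ρl - ρs) / (ρl - ρg) then ρg else ρl|) ω hω ?_).symm
    exact ((hp.continuous.intervalIntegrable _ _).sub
      (integral_ite_le continuous_const continuous_const ⟨hθ0.le, hθ1.le⟩).1).abs
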